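/- **Palm version of a nested Manhattan grid.** For a random street system $S$ (a random closed subset of $\mathbb R^2$), write $|B|$ for the length (one-dimensional Hausdorff measure) of $B$, let $\gamma(S)=\mathbb E\big[|S\cap[0,1]^2|\big]$ be its street intensity, and, if $0<\gamma(S)<\infty$, call a random street system $S^*$ a *Palm version* of $S$ if $$\mathbb E[f(S^*)]=\frac1{\gamma(S)}\,\mathbb E\Big[\int_{S\cap[0,1]^2} f(S-y)\,{\rm d}y\Big]$$ for every non-negative measurable $f$, where ${\rm d}y$ denotes integration with respect to length. For an inter-arrival distribution $\mathcal L(I)$ with $I>0$ almost surely and $\mathbb E[I]<\infty$, the stationary renewal process is the random point set with points $$A_i=UI^*+\sum_{1\le j\le i-1}I_j,\qquad A_{-i}=(U-1)I^*-\sum_{1\le j\le i-1}I_{-j},\qquad i\ge1,$$ where the $I_j$, $j\ne0$, are iid copies of $I$, the variable $I^*$ has the length-biased distribution $\mathbb E[g(I^*)]=\mathbb E[I\,g(I)]/\mathbb E[I]$, the variable $U$ is uniform on $[0,1]$, and all of these are independent. A *Manhattan grid* is $(\mathbb R\times X^{\rm h})\cup(X^{\rm v}\times\mathbb R)$ with independent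 stationary renewal processes $X^{\rm h},X^{\rm v}$ (their inter-arrival distributions may be equal or different). Let $S$ be a Manhattan grid and let $(S_i)_{i\in\mathbb Z^2}$ be iid Manhattan grids (with inter-arrival distributions possibly different from those of $S$), independent of $S$. Index the blocks (cells) $\Xi_i$ of a grid by $i\in\mathbb Z^2$ in the order of their horizontal and vertical position, with $\Xi_{(0,0)}$ the block containing the origin (the one to the upper right if the origin lies on a street). Put $$h(S;(S_i)_i)=S\cup\bigcup_{i}(\Xi_i\cap S_i),$$ and let $\bar S=h(S;(S_i)_i)$ be the nested Manhattan grid. Let $\gamma,\gamma_1,\bar\gamma$ be the street intensities of $S$, $S_{(0,0)}$, $\bar S$. Let $S^*$ and $S_{(0,0)}^*$ be Palm versions of $S$ and $S_{(0,0)}$ and let $U$ be uniform on $[0,1]$, such that $U,S,S^*,S_{(0,0)}^*,(S_i)_i$ are all independent. Then $\bar\gamma=\gamma+\gamma_1$, and the random street system $$\bar S^{\bullet}=\begin{cases}h\big(S^*;(S_i)_i\big)&\text{if }U\le\gamma/\bar\gamma,\\[2pt] h\big(S;\,S_{(0,0)}^*,(S_i)_{i\ne(0,0)}\big)&\text{otherwise,}\end{cases}$$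 is a Palm version of $\bar S$. That is, with probability $\gamma/\bar\gamma$ the main grid is replaced by its Palm version, and with probability $\gamma_1/\bar\gamma$ the side-street grid of the block containing the origin is replaced by its Palm version. -/

import Mathlib

open MeasureTheory ProbabilityTheory TopologicalSpace
open scoped ENNReal

noncomputable section

namespace Manhattan

/-! ### Random closed sets -/

/-- The `σ`-algebra on closed sets generated by the events that a compact set is hit
(the Borel `σ`-algebra of the Fell topology when the space is locally compact and second
countable). -/
instance instMeasurableSpaceCloseds {X : Type*} [TopologicalSpace X] :
    MeasurableSpace (Closeds X) :=
  MeasurableSpace.generateFrom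
    {A | ∃ K : Set X, IsCompact K ∧ A = {F : Closeds X | ((F : Set X) ∩ K).Nonempty}}

/-- The Euclidean plane; coordinate `0` is horizontal and coordinate `1` is vertical. -/
abbrev Plane : Type := EuclideanSpace ℝ (Fin 2)

/-- A street system is a closed subset of the plane. -/
abbrev StreetSystem : Type := Closeds Plane

/-- The translate `S - y`. -/
def StreetSystem.shift (S : StreetSystem) (y : Plane) : StreetSystem :=
  ⟨{p | p + y ∈ S}, S.isClosed.preimage (continuous_add_const y)⟩

/-- The unit square `[0, 1]²`. -/
def unitSquare : Set Plane := {p | ∀ i, p i ∈ Set.Icc (0 : ℝ) 1}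

/-- The street intensity `γ`: the expected street length in the unit square. Length is
one-dimensional Hausdorff measure. -/
def intensity {Ω : Type*} [MeasurableSpace Ω] (P : Measure Ω) (S : Ω → StreetSystem) : ℝ≥0∞ :=
  ∫⁻ ω, Measure.hausdorffMeasure 1 ((S ω : Set Plane) ∩ unitSquare) ∂P

/-- `S'` is a Palm version of the random street system `S`:
`E[f(S')] = γ⁻¹ E[∫_{S ∩ [0,1]²} f(S - y) dy]` for all measurable `f ≥ 0`. -/
def IsPalmVersion {Ω Ω' : Type*} [MeasurableSpace Ω] [MeasurableSpace Ω']
    (P : Measure Ω) (S : Ω → StreetSystem) (P' : Measure Ω') (S' : Ω' → StreetSystem) : Prop :=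
  AEMeasurable S' P' ∧
    ∀ f : StreetSystem → ℝ≥0∞, Measurable f →
      ∫⁻ ω, f (S' ω) ∂P' =
        (intensity P S)⁻¹ *
          ∫⁻ ω, (∫⁻ y in (S ω : Set Plane) ∩ unitSquare,
            f ((S ω).shift y) ∂(Measure.hausdorffMeasure 1)) ∂P

/-! ### Stationary renewal processes -/

/-- Inter-arrival distributions: laws of almost surely positive random variables with finite
mean. -/
structure IsInterArrivalLaw (ν : Measure ℝ) : Prop where
  pos : ∀ᵐ x ∂ν, 0 < x
  integrable : Integrable (fun x : ℝ => x) ν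

/-- The length-biased distribution: `E[f(I*)] = E[I f(I)] / E[I]`. -/
def lengthBiased (ν : Measure ℝ) : Measure ℝ :=
  (∫⁻ x, ENNReal.ofReal x ∂ν)⁻¹ • ν.withDensity ENNReal.ofReal

/-- The arrival times on either side of the origin, when the segment containing the origin has
length `L`, is cut by the origin in proportion `u`, and the other segments have lengths
`I 1, I 2, …` (to the right) and `I (-1), I (-2), …` (to the left); `I 0` is not used. -/
def arrivals (I : ℤ → ℝ) (L u : ℝ) : Set ℝ :=
  Set.range (fun k : ℕ => u * L + ∑ j ∈ Finset.range k, I (j + 1)) ∪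
    Set.range (fun k : ℕ => (u - 1) * L - ∑ j ∈ Finset.range k, I (-(j + 1)))

/-- The uniform distribution on `[0, 1]`. -/
def unif : Measure ℝ := volume.restrict (Set.Icc 0 1)

/-- The law of the stationary renewal process with inter-arrival distribution `ν`, as a random
closed subset of the line: the `I j` are iid with law `ν`, `L` has the length-biased law, `u` is
uniform, and all are independent. The closure has no effect almost surely. -/
def stationaryRenewalLaw (ν : Measure ℝ) [IsProbabilityMeasure ν] : Measure (Closeds ℝ) :=
  ((Measure.infinitePi fun _ : ℤ => ν).prod ((lengthBiased ν).prod unif)).map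
    fun q => Closeds.closure (arrivals q.1 q.2.1 q.2.2)

/-! ### Manhattan grids -/

/-- The grid `(ℝ × H) ∪ (V × ℝ)`. -/
def grid (H V : Closeds ℝ) : StreetSystem :=
  ⟨{p | p 1 ∈ H} ∪ {p | p 0 ∈ V},
    (H.isClosed.preimage (by fun_prop)).union (V.isClosed.preimage (by fun_prop))⟩

/-- The law of the Manhattan grid built from two independent stationary renewal processes, with
inter-arrival distribution `νh` for the horizontal streets and `νv` for the vertical ones. -/
def manhattanLaw (νh νv : Measure ℝ) [IsProbabilityMeasure νh] [IsProbabilityMeasure νv] :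
    Measure StreetSystem :=
  ((stationaryRenewalLaw νh).prod (stationaryRenewalLaw νv)).map fun q => grid q.1 q.2

/-! ### Nesting -/

/-- The coordinates of the vertical lines contained in `S`. -/
def verticals (S : StreetSystem) : Set ℝ := {x | ∀ p : Plane, p 0 = x → p ∈ S}

/-- The coordinates of the horizontal lines contained in `S`. -/
def horizontals (S : StreetSystem) : Set ℝ := {y | ∀ p : Plane, p 1 = y → p ∈ S}

/-- If `A = {… < a₋₁ < a₀ ≤ 0 < a₁ < …}` is locally finite, then `cellIndex A x` is the `n` with
`aₙ ≤ x < aₙ₊₁`. -/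
def cellIndex (A : Set ℝ) (x : ℝ) : ℤ :=
  ((A ∩ Set.Ioc 0 x).ncard : ℤ) - ((A ∩ Set.Ioc x 0).ncard : ℤ)

/-- The index of the block of the grid `S` containing `p`; the block of the origin is `(0, 0)`.
Points on a street are assigned to one of the adjacent blocks. -/
def blockIndex (S : StreetSystem) (p : Plane) : ℤ × ℤ :=
  (cellIndex (verticals S) (p 0), cellIndex (horizontals S) (p 1))

/-- The street system obtained from main streets `S` by adding, inside block number `i` of `S`,
the part of `T i` in that block. The closure has no effect when `S` is a grid with locally finite
coordinate sets. -/
def nest (S : StreetSystem) (T : ℤ × ℤ → StreetSystem) : StreetSystem :=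
  Closeds.closure ((S : Set Plane) ∪ {p | p ∈ T (blockIndex S p)})

end Manhattan

end

/-! Freeze the main grid `S` and split the length of the nested grid in the unit square into the
main streets and, for each `i`, the part of the side grid `T i` in block `i`. The overlap is
negligible: the main streets in the square have finite length, hence area zero, and a stationary
system with a Palm version almost surely meets a fixed compact set of area zero in length zero.

If the nested grid is viewed from a point `y`, the result is again nested: the main grid is `S - y`,
and the side grids are relabelled by the block of `y` and translated
(`HasLocallyFiniteLines.nest_shift`). For `y` on a main street, the side grids seen from `y` are
still iid with the same stationary law, so this part contributes the intensity of `S` times the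
expectation over the nested Palm version of `S`. For `y` on a side street in block `i`, the grid `T
i` is resampled independently of the others and the refined Campbell formula
`IsPalmVersion.lintegral_eq` is applied to it. Block `i` becomes the block of the origin, the Palm
version of the side grid enters there, and `y` becomes Lebesgue distributed on block `i`. The blocks
partition the square, so summing over `i` leaves an integral over the square, from which
stationarity of `S` removes `y`. This is `IsPalmVersion.lintegral_palmIntegral_nest`. The test
function `1` gives the sum of the intensities, and the variable `U` realises the resulting mixture.

The Campbell formula follows from uniqueness of Haar measure: for a fixed event `A`, the mean length
of the points in `B` whose view lies in `A` is a translation-invariant, locally finite measure of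
`B`. Stationarity of renewal processes is a mass transport argument
(`lintegral_mul_eq_of_gapShift_invariant`): length-biasing and a uniform position together amount to
Lebesgue measure on one gap, and any other choice of one representative per orbit gives the same
integral.

The remaining work is measurability for the hitting `σ`-algebra, where length, contained lines,
block indices and nesting are each reduced to countably many hitting events. Nesting is replaced by
`nestM`, which agrees with it almost surely. -/

noncomputable section

namespace Manhattan

/-! ### Measurability of maps into the closed subsets of a proper metric space -/

section Closeds

variable {X : Type*} [MetricSpace X]

theorem measurableSet_hits_compact {K : Set X} (hK : IsCompact K) :
    MeasurableSet {F : Closeds X | ((F : Set X) ∩ K).Nonempty} :=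
  MeasurableSpace.measurableSet_generateFrom ⟨K, hK, rfl⟩

variable [ProperSpace X]

theorem measurableSet_hits_closed {C : Set X} (hC : IsClosed C) :
    MeasurableSet {F : Closeds X | ((F : Set X) ∩ C).Nonempty} := by
  have h : {F : Closeds X | ((F : Set X) ∩ C).Nonempty} =
      ⋃ n, {F : Closeds X | ((F : Set X) ∩ (C ∩ compactCovering X n)).Nonempty} := by
    ext F
    simp only [Set.mem_ofPred_eq, Set.mem_iUnion]
    constructor
    · rintro ⟨x, hx, hxC⟩
      obtain ⟨n, hn⟩ := exists_mem_compactCovering x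
      exact ⟨n, x, hx, hxC, hn⟩
    · rintro ⟨n, x, hx, hxC, -⟩
      exact ⟨x, hx, hxC⟩
  rw [h]
  exact .iUnion fun n => measurableSet_hits_compact ((isCompact_compactCovering X n).inter_left hC)

theorem measurableSet_hits_iUnion {ι : Type*} [Countable ι] {C : ι → Set X}
    (hC : ∀ i, IsClosed (C i)) :
    MeasurableSet {F : Closeds X | ((F : Set X) ∩ ⋃ i, C i).Nonempty} := by
  simp only [Set.inter_iUnion, Set.nonempty_iUnion, Set.ofPred_exists]
  exact .iUnion fun i => measurableSet_hits_closed (hC i)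

theorem measurableSet_hits_open {U : Set X} (hU : IsOpen U) :
    MeasurableSet {F : Closeds X | ((F : Set X) ∩ U).Nonempty} := by
  obtain ⟨C, hC, -, rfl, -⟩ := hU.exists_iUnion_isClosed
  exact measurableSet_hits_iUnion hC

/-- A distance is below `r` exactly when an open ball is hit. With `measurable_closeds_of_infEDist`
as converse, random closed sets can be handled through their distance functions. -/
theorem measurable_infEDist (x : X) :
    Measurable fun F : Closeds X => Metric.infEDist x (F : Set X) := by
  refine measurable_of_Iio fun r => ?_
  have h : (fun F : Closeds X => Metric.infEDist x (F : Set X)) ⁻¹' Set.Iio r =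
      {F : Closeds X | ((F : Set X) ∩ {y | edist x y < r}).Nonempty} := by
    ext F
    simp [Metric.infEDist_lt_iff, Set.Nonempty]
  rw [h]
  exact measurableSet_hits_open (isOpen_lt (by fun_prop) (by fun_prop))

variable {Ω : Type*} [MeasurableSpace Ω]

/-- A compact set is hit if and only if its points come arbitrarily close to the closed set. -/
theorem measurable_closeds_of_approx {S : Ω → Closeds X} (f : X → ℕ → Set Ω)
    (hf : ∀ x n, MeasurableSet (f x n))
    (hfS : ∀ K : Set X, IsCompact K → ∀ D ⊆ K, D.Countable → K ⊆ closure D → ∀ ω,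
      (((S ω : Set X) ∩ K).Nonempty ↔ ∀ n, ∃ x ∈ D, ω ∈ f x n)) :
    Measurable S := by
  refine measurable_generateFrom ?_
  rintro _ ⟨K, hK, rfl⟩
  obtain ⟨D, hDK, hD, hKD⟩ := (IsSeparable.of_separableSpace K).exists_countable_dense_subset
  have h : S ⁻¹' {F : Closeds X | ((F : Set X) ∩ K).Nonempty} = ⋂ n, ⋃ x ∈ D, f x n := by
    ext ω
    simp [hfS K hK D hDK hD hKD ω]
  rw [h]
  exact .iInter fun n => .biUnion hD fun x _ => hf x n

/-- The distance to a closed set attains its minimum on a compact set, and the set is hit exactly if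
this minimum is zero; by density, countably many points detect it. -/
theorem measurable_closeds_of_infEDist {S : Ω → Closeds X}
    (h : ∀ x, Measurable fun ω => Metric.infEDist x (S ω : Set X)) : Measurable S := by
  refine measurable_closeds_of_approx
    (fun x (n : ℕ) => {ω | Metric.infEDist x (S ω : Set X) < (n + 1 : ℝ≥0∞)⁻¹})
    (fun x n => measurableSet_lt (h x) measurable_const) fun K hK D hDK _ hKD ω => ?_
  constructor
  · rintro ⟨y, hy, hyK⟩ n
    obtain ⟨x, hx, hxy⟩ := EMetric.mem_closure_iff.1 (hKD hyK) (n + 1 : ℝ≥0∞)⁻¹ (by simp)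
    refine ⟨x, hx, (Metric.infEDist_le_edist_of_mem hy).trans_lt ?_⟩
    rwa [edist_comm]
  · intro H
    -- Needed only to know that `K` is nonempty, so that a minimum exists.
    obtain ⟨x₀, hx₀, -⟩ := H 0
    obtain ⟨y, hyK, hy⟩ := hK.exists_isMinOn ⟨x₀, hDK hx₀⟩
      (f := fun x => Metric.infEDist x (S ω : Set X)) Metric.continuous_infEDist.continuousOn
    refine ⟨y, ?_, hyK⟩
    refine (Metric.mem_iff_infEDist_zero_of_closed (S ω).isClosed).2 ?_
    by_contra hne
    obtain ⟨n, hn⟩ := ENNReal.exists_inv_nat_lt hne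
    obtain ⟨x, hx, hxn⟩ := H n
    refine absurd ((hy (hDK hx)).trans hxn.le) (not_le.2 (lt_of_le_of_lt ?_ hn))
    exact ENNReal.inv_le_inv.2 le_self_add

theorem measurable_infEDist_uncurry [MeasurableSpace X] [BorelSpace X] :
    Measurable fun q : X × Closeds X => Metric.infEDist q.1 (q.2 : Set X) :=
  measurable_uncurry_of_continuous_of_measurable
    (u := fun x (F : Closeds X) => Metric.infEDist x (F : Set X))
    (fun _ => Metric.continuous_infEDist) measurable_infEDist

theorem measurable_closeds_closure_range {ι : Type*} [Countable ι] [MeasurableSpace X]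
    [BorelSpace X] {a : ι → Ω → X} (ha : ∀ i, Measurable (a i)) :
    Measurable fun ω => Closeds.closure (Set.range fun i => a i ω) := by
  refine measurable_closeds_of_infEDist fun x => ?_
  have h (ω : Ω) : Metric.infEDist x (Closeds.closure (Set.range fun i => a i ω) : Set X) =
      ⨅ i, edist x (a i ω) := by
    change Metric.infEDist x (closure _) = _
    rw [Metric.infEDist_closure, ← Set.iUnion_singleton_eq_range, Metric.infEDist_iUnion]
    simp
  simp only [h]
  exact .iInf fun i => measurable_edist_right.comp (ha i)

end Closeds

/-! ### Translations and grids as measurable operations -/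

/-- The translate `F - y` of a closed set. -/
def translate {E : Type*} [TopologicalSpace E] [Add E] [ContinuousAdd E] (F : Closeds E) (y : E) :
    Closeds E :=
  ⟨{p | p + y ∈ F}, F.isClosed.preimage (continuous_add_const y)⟩

theorem measurable_translate {E : Type*} [NormedAddCommGroup E] [ProperSpace E]
    [MeasurableSpace E] [BorelSpace E] :
    Measurable fun q : Closeds E × E => translate q.1 q.2 := by
  refine measurable_closeds_of_infEDist fun x => ?_
  have h (q : Closeds E × E) : Metric.infEDist x (translate q.1 q.2 : Set E) =
      Metric.infEDist (x + q.2) (q.1 : Set E) := by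
    have := Metric.infEDist_image (IsometryEquiv.addRight q.2).isometry
      (x := x) (t := (translate q.1 q.2 : Set E))
    rw [← this]
    congr 1
    ext p
    change (∃ z, z + q.2 ∈ q.1 ∧ z + q.2 = p) ↔ p ∈ q.1
    exact ⟨fun ⟨z, hz, h⟩ => h ▸ hz, fun h => ⟨p - q.2, by simpa using h, by simp⟩⟩
  simp only [h]
  exact measurable_infEDist_uncurry.comp
    ((measurable_const.add measurable_snd).prodMk measurable_fst)

theorem measurable_shift : Measurable fun q : StreetSystem × Plane => q.1.shift q.2 :=
  measurable_translate

theorem mem_shift {S : StreetSystem} {y p : Plane} : p ∈ S.shift y ↔ p + y ∈ S := Iff.rfl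

theorem measurable_grid : Measurable fun q : Closeds ℝ × Closeds ℝ => grid q.1 q.2 := by
  -- Changing only coordinate `i` is the cheapest way to reach a union of lines orthogonal to axis
  -- `i`, so the distance is one-dimensional.
  have key (i : Fin 2) (x : Plane) (H : Closeds ℝ) :
      Metric.infEDist x {p : Plane | p i ∈ H} = Metric.infEDist (x i) (H : Set ℝ) := by
    apply le_antisymm
    · refine Metric.le_infEDist.2 fun t ht => ?_
      refine (Metric.infEDist_le_edist_of_mem
        (y := WithLp.toLp 2 (Function.update (x : Fin 2 → ℝ) i t))
        (show Function.update (x : Fin 2 → ℝ) i t i ∈ H by simpa using ht)).trans (le_of_eq ?_)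
      have hu (j : Fin 2) : (WithLp.toLp 2 (Function.update (x : Fin 2 → ℝ) i t) : Plane) j =
        Function.update (x : Fin 2 → ℝ) i t j := rfl
      rw [EuclideanSpace.edist_eq, Finset.sum_eq_single i]
      · rw [hu, Function.update_self, ← ENNReal.rpow_natCast, ← ENNReal.rpow_mul]
        norm_num
      · intro j _ hj
        rw [hu, Function.update_of_ne hj, edist_self]
        norm_num
      · exact fun h => absurd (Finset.mem_univ i) h
    · refine Metric.le_infEDist.2 fun p hp => ?_
      refine (Metric.infEDist_le_edist_of_mem (y := p i) hp).trans ?_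
      exact PiLp.edist_apply_le x p i
  refine measurable_closeds_of_infEDist fun x => ?_
  have h (q : Closeds ℝ × Closeds ℝ) : Metric.infEDist x (grid q.1 q.2 : Set Plane) =
      Metric.infEDist (x 1) (q.1 : Set ℝ) ⊓ Metric.infEDist (x 0) (q.2 : Set ℝ) := by
    change Metric.infEDist x ({p | p 1 ∈ q.1} ∪ {p | p 0 ∈ q.2}) = _
    rw [Metric.infEDist_union, key, key]
  simp only [h]
  exact ((measurable_infEDist _).comp measurable_fst).inf
    ((measurable_infEDist _).comp measurable_snd)

/-! ### Measurability of the length of a closed set -/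

section Length

open Filter Topology Metric

variable {X : Type*} [MetricSpace X] [MeasurableSpace X] [BorelSpace X]

/-- A near-optimal cover is thickened to an open one. One half of `ε` pays for the mesh and for the
excess over the infimum, the other half for all thickenings together. -/
theorem exists_open_cover_of_hausdorffMeasure_le {C : Set X} {c : ℝ≥0∞} (hc : c ≠ ∞)
    (h : Measure.hausdorffMeasure 1 C ≤ c) {ε : ℝ≥0∞} (hε : ε ≠ 0) :
    ∃ U : ℕ → Set X, (∀ n, IsOpen (U n)) ∧ C ⊆ ⋃ n, U n ∧ (∀ n, ediam (U n) ≤ ε) ∧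
      ∑' n, ediam (U n) ≤ c + ε := by
  have hε2 : ε / 2 ≠ 0 := by simpa using hε
  rw [Measure.hausdorffMeasure_apply] at h
  have h1 : (⨅ (t : ℕ → Set X) (_ : C ⊆ ⋃ n, t n) (_ : ∀ n, ediam (t n) ≤ ε / 2),
      ∑' n, ⨆ _ : (t n).Nonempty, ediam (t n) ^ (1 : ℝ)) < c + ε / 2 :=
    ((le_iSup₂ (f := fun (r : ℝ≥0∞) (_ : 0 < r) =>
      ⨅ (t : ℕ → Set X) (_ : C ⊆ ⋃ n, t n) (_ : ∀ n, ediam (t n) ≤ r),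
        ∑' n, ⨆ _ : (t n).Nonempty, ediam (t n) ^ (1 : ℝ)) (ε / 2)
          (pos_iff_ne_zero.2 hε2)).trans h).trans_lt (ENNReal.lt_add_right hc hε2)
  simp only [iInf_lt_iff] at h1
  obtain ⟨t, htC, ht, hsum⟩ := h1
  obtain ⟨η, hη, hηsum⟩ := ENNReal.exists_pos_sum_of_countable
    (ε := ε / 2 / 2) (by simpa using hε) ℕ
  have hη2 (n : ℕ) : ediam (thickening (η n) (t n)) ≤ ediam (t n) + 2 * η n :=
    ediam_thickening_le _
  have hs2 : ∑' n, 2 * (η n : ℝ≥0∞) ≤ ε / 2 := by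
    rw [ENNReal.tsum_mul_left]
    calc 2 * ∑' n, (η n : ℝ≥0∞) ≤ 2 * (ε / 2 / 2) := by gcongr
      _ = ε / 2 := ENNReal.mul_div_cancel (by simp) (by simp)
  have ht' (n : ℕ) : ediam (t n) ≤ ⨆ _ : (t n).Nonempty, ediam (t n) ^ (1 : ℝ) := by
    rcases (t n).eq_empty_or_nonempty with h0 | h0
    · simp [h0]
    · simp [h0]
  refine ⟨fun n => thickening (η n) (t n), fun n => isOpen_thickening,
    htC.trans (Set.iUnion_mono fun n => self_subset_thickening (hη n) _), fun n => ?_, ?_⟩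
  · calc ediam (thickening (η n) (t n)) ≤ ε / 2 + ε / 2 :=
          (hη2 n).trans (add_le_add (ht n) ((ENNReal.le_tsum n).trans hs2))
      _ = ε := ENNReal.add_halves ε
  · calc ∑' n, ediam (thickening (η n) (t n))
        ≤ ∑' n, (ediam (t n) + 2 * η n) := ENNReal.tsum_le_tsum hη2
      _ = ∑' n, ediam (t n) + ∑' n, 2 * (η n : ℝ≥0∞) := ENNReal.tsum_add
      _ ≤ (c + ε / 2) + ε / 2 :=
          add_le_add ((ENNReal.tsum_le_tsum ht').trans hsum.le) hs2
      _ = c + ε := by rw [add_assoc, ENNReal.add_halves]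

/-- For compact sets, the one-dimensional Hausdorff measure is determined by finite covers from a
fixed countable family of open sets. -/
theorem hausdorffMeasure_one_le_iff [SecondCountableTopology X] {b : ℕ → Set X}
    (hb : IsTopologicalBasis (Set.range b)) {C : Set X} (hC : IsCompact C) {c : ℝ≥0∞}
    (hc : c ≠ ∞) :
    Measure.hausdorffMeasure 1 C ≤ c ↔ ∀ m : ℕ, ∃ J : Finset (Finset ℕ),
      C ⊆ (⋃ s ∈ J, ⋃ j ∈ s, b j) ∧ (∀ s ∈ J, ediam (⋃ j ∈ s, b j) ≤ (m + 1 : ℝ≥0∞)⁻¹) ∧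
        ∑ s ∈ J, ediam (⋃ j ∈ s, b j) ≤ c + (m + 1 : ℝ≥0∞)⁻¹ := by
  classical
  constructor
  · intro h m
    obtain ⟨U, hU, hCU, hd, hs⟩ :=
      exists_open_cover_of_hausdorffMeasure_le hc h (ε := (m + 1 : ℝ≥0∞)⁻¹) (by simp)
    let I := {p : ℕ × ℕ // b p.2 ⊆ U p.1}
    obtain ⟨t, ht⟩ := hC.elim_finite_subcover (fun i : I => b i.1.2)
      (fun i => hb.isOpen ⟨_, rfl⟩) (by
        intro x hx
        obtain ⟨n, hn⟩ := Set.mem_iUnion.1 (hCU hx)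
        obtain ⟨_, ⟨j, rfl⟩, hxj, hj⟩ := hb.exists_subset_of_mem_open hn (hU n)
        exact Set.mem_iUnion.2 ⟨⟨(n, j), hj⟩, hxj⟩)
    -- The basic sets of the subcover are grouped by the `U n` that contains them, so each `U n` is
    -- charged only once in the sum of diameters.
    let s : ℕ → Finset ℕ := fun n => (t.filter fun i => i.1.1 = n).image fun i => i.1.2
    have hsU (n : ℕ) : (⋃ j ∈ s n, b j) ⊆ U n := by
      simp only [s, Finset.mem_image, Finset.mem_filter, Set.iUnion_subset_iff]
      rintro j ⟨i, ⟨-, rfl⟩, rfl⟩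
      exact i.2
    refine ⟨(t.image fun i => i.1.1).image s, ?_, ?_, ?_⟩
    · intro x hx
      obtain ⟨i, hi, hxi⟩ := Set.mem_iUnion₂.1 (ht hx)
      refine Set.mem_iUnion₂.2 ⟨s i.1.1,
        Finset.mem_image_of_mem _ (Finset.mem_image.2 ⟨i, hi, rfl⟩),
        Set.mem_iUnion₂.2 ⟨i.1.2, ?_, hxi⟩⟩
      exact Finset.mem_image.2 ⟨i, by simp [hi], rfl⟩
    · intro s' hs'
      obtain ⟨n, -, rfl⟩ := Finset.mem_image.1 hs'
      exact (ediam_mono (hsU n)).trans (hd n)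
    · calc _ ≤ ∑ n ∈ t.image fun i => i.1.1, ediam (⋃ j ∈ s n, b j) :=
            Finset.sum_image_le_of_nonneg (f := fun s => ediam (⋃ j ∈ s, b j)) fun _ _ => zero_le
        _ ≤ ∑ n ∈ t.image fun i => i.1.1, ediam (U n) :=
            Finset.sum_le_sum fun n _ => ediam_mono (hsU n)
        _ ≤ _ := (ENNReal.sum_le_tsum _).trans hs
  · intro h
    choose J hJ hJd hJs using h
    have hlim : Tendsto (fun m : ℕ => (m + 1 : ℝ≥0∞)⁻¹) atTop (𝓝 0) := by
      have := (tendsto_add_atTop_iff_nat 1).2 ENNReal.tendsto_inv_nat_nhds_zero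
      simpa using this
    refine (Measure.hausdorffMeasure_le_liminf_sum 1 C (l := atTop) (fun m : ℕ => (m + 1 : ℝ≥0∞)⁻¹)
      hlim (ι := fun m => J m) (fun m s => ⋃ j ∈ (s : Finset ℕ), b j)
      (.of_forall fun m s => hJd m s s.2) (.of_forall fun m x hx => ?_)).trans ?_
    · obtain ⟨s, hs, hxs⟩ := Set.mem_iUnion₂.1 (hJ m hx)
      exact Set.mem_iUnion.2 ⟨⟨s, hs⟩, hxs⟩
    · have h2 : Tendsto (fun m : ℕ => c + (m + 1 : ℝ≥0∞)⁻¹) atTop (𝓝 (c + 0)) :=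
        tendsto_const_nhds.add hlim
      rw [add_zero] at h2
      rw [← h2.liminf_eq]
      refine liminf_le_liminf (.of_forall fun m => ?_)
      simp only [ENNReal.rpow_one]
      rw [Finset.sum_coe_sort (J m) fun s => ediam (⋃ j ∈ s, b j)]
      exact hJs m

/-- Length on the part in a compact set `K` of a closed set, if that part has finite length. -/
def lengthOn (K : Set X) : Closeds X → Measure X :=
  fun F => (if Measure.hausdorffMeasure 1 ((F : Set X) ∩ K) < ∞ then 1 else (0 : ℝ≥0∞)) •
    (Measure.hausdorffMeasure 1).restrict ((F : Set X) ∩ K)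

theorem lengthOn_eq {K : Set X} {F : Closeds X}
    (h : Measure.hausdorffMeasure 1 ((F : Set X) ∩ K) < ∞) :
    lengthOn K F = (Measure.hausdorffMeasure 1).restrict ((F : Set X) ∩ K) := by
  simp [lengthOn, h]

instance (K : Set X) (F : Closeds X) : IsFiniteMeasure (lengthOn K F) := by
  rw [lengthOn]
  split_ifs with h
  · rw [one_smul]
    exact ⟨by simpa using h⟩
  · rw [zero_smul]
    infer_instance

variable [ProperSpace X]

/-- Bounded length is a countable condition on finite covers by basic open sets, and being covered
by such a family means missing the compact set that it leaves of `K`. -/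
theorem measurable_length_inter {K : Set X} (hK : IsCompact K) :
    Measurable fun F : Closeds X => Measure.hausdorffMeasure 1 ((F : Set X) ∩ K) := by
  refine measurable_of_Iic fun c => ?_
  rcases eq_or_ne c ∞ with rfl | hc
  · simp
  obtain ⟨B, hBc, -, hB⟩ := exists_countable_basis X
  obtain ⟨b, hb⟩ : ∃ b : ℕ → Set X, IsTopologicalBasis (Set.range b) := by
    -- A basis may be empty when the space is; the constant enumeration by `∅` then serves.
    rcases B.eq_empty_or_nonempty with rfl | hne
    · refine ⟨fun _ => ∅, ?_⟩
      have : IsTopologicalBasis (insert ∅ (∅ : Set (Set X))) := hB.insert_empty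
      simpa using this
    · obtain ⟨b, rfl⟩ := hBc.exists_eq_range hne
      exact ⟨b, hB⟩
  have h : (fun F : Closeds X => Measure.hausdorffMeasure 1 ((F : Set X) ∩ K)) ⁻¹' Set.Iic c =
      ⋂ m : ℕ, ⋃ (J : Finset (Finset ℕ))
        (_ : (∀ s ∈ J, ediam (⋃ j ∈ s, b j) ≤ (m + 1 : ℝ≥0∞)⁻¹) ∧
          ∑ s ∈ J, ediam (⋃ j ∈ s, b j) ≤ c + (m + 1 : ℝ≥0∞)⁻¹),
        {F : Closeds X | ((F : Set X) ∩ (K \ ⋃ s ∈ J, ⋃ j ∈ s, b j)).Nonempty}ᶜ := by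
    ext F
    simp only [Set.mem_preimage, Set.mem_Iic,
      hausdorffMeasure_one_le_iff hb (hK.inter_left F.isClosed) hc, Set.mem_iInter, Set.mem_iUnion,
      Set.mem_compl_iff, Set.mem_ofPred_eq, Set.not_nonempty_iff_eq_empty, ← Set.inter_sdiff_assoc,
      Set.sdiff_eq_empty, exists_prop]
    exact forall_congr' fun m => exists_congr fun J => and_comm
  rw [h]
  refine .iInter fun m => .iUnion fun J => .iUnion fun _ => (measurableSet_hits_compact ?_).compl
  exact hK.diff (isOpen_biUnion fun s _ => isOpen_biUnion fun j _ => hb.isOpen ⟨j, rfl⟩)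

/-- The closed sets are a generating `π`-system on which `measurable_length_inter` applies. The
cut-off in `lengthOn` makes all measures finite, as the extension requires. -/
theorem measurable_lengthOn {K : Set X} (hK : IsCompact K) : Measurable (lengthOn K) := by
  have key {C : Set X} (hC : IsClosed C) : Measurable fun F : Closeds X => lengthOn K F C := by
    simp only [lengthOn, Measure.smul_apply, smul_eq_mul, Measure.restrict_apply hC.measurableSet]
    refine Measurable.mul (.ite (measurableSet_lt (measurable_length_inter hK) measurable_const)
      measurable_const measurable_const) ?_
    convert measurable_length_inter (hK.inter_left hC) using 3 with F
    rw [← Set.inter_assoc, ← Set.inter_assoc, Set.inter_comm C]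
  refine .measure_of_isPiSystem (S := {C | IsClosed C}) ?_ isPiSystem_isClosed
    (fun C hC => key hC) (key isClosed_univ)
  rw [BorelSpace.measurable_eq (α := X), borel_eq_generateFrom_isClosed]

/-- `lengthOn K` as a kernel. -/
def lengthOnKernel {K : Set X} (hK : IsCompact K) : Kernel (Closeds X) X where
  toFun := lengthOn K
  measurable' := measurable_lengthOn hK

theorem lengthOnKernel_apply {K : Set X} (hK : IsCompact K) (F : Closeds X) :
    lengthOnKernel hK F = lengthOn K F := rfl

/-- Measurable families of finite measures are s-finite kernels. -/
theorem isSFiniteKernel_of_isFiniteMeasure {α β : Type*} [MeasurableSpace α] [MeasurableSpace β]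
    (κ : Kernel α β) (h : ∀ a, IsFiniteMeasure (κ a)) : IsSFiniteKernel κ := by
  have hm : Measurable fun a => κ a Set.univ := κ.measurable_coe .univ
  -- Dividing by one plus the total mass gives a finite kernel, from which `κ` is recovered by a
  -- finite density.
  let η : Kernel α β :=
    { toFun := fun a => (1 + κ a Set.univ)⁻¹ • κ a
      measurable' := by
        refine Measure.measurable_of_measurable_coe _ fun s hs => ?_
        simp only [Measure.smul_apply, smul_eq_mul]
        exact (measurable_const.add hm).inv.mul (κ.measurable_coe hs) }
  have hη (a : α) : η a = (1 + κ a Set.univ)⁻¹ • κ a := rfl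
  have : IsFiniteKernel η := by
    refine ⟨1, ENNReal.one_lt_top, fun a => ?_⟩
    rw [hη, Measure.smul_apply, smul_eq_mul, mul_comm, ← div_eq_mul_inv]
    exact ENNReal.div_le_of_le_mul (by rw [one_mul]; exact le_add_self)
  have hf : Measurable fun q : α × β => 1 + κ q.1 Set.univ :=
    measurable_const.add (hm.comp measurable_fst)
  have hκ : κ = η.withDensity fun a _ => 1 + κ a Set.univ := by
    ext a : 1
    rw [Kernel.withDensity_apply _ hf, withDensity_const, hη, smul_smul,
      ENNReal.mul_inv_cancel (by simp) (by simp [measure_ne_top]), one_smul]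
  rw [hκ]
  exact Kernel.IsSFiniteKernel.withDensity _ fun a _ => by simp [measure_ne_top]

instance {K : Set X} (hK : IsCompact K) : IsSFiniteKernel (lengthOnKernel hK) :=
  isSFiniteKernel_of_isFiniteMeasure _ fun F => inferInstanceAs (IsFiniteMeasure (lengthOn K F))

/-- Closed sets of locally finite length. -/
def HasLocallyFiniteLength (F : Closeds X) : Prop :=
  ∀ n, Measure.hausdorffMeasure 1 ((F : Set X) ∩ compactCovering X n) < ∞

/-- Length along a closed set of locally finite length. -/
def lengthKernel : Kernel (Closeds X) X :=
  Kernel.sum fun n => (lengthOnKernel (isCompact_compactCovering X n)).restrict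
    (MeasurableSet.disjointed (fun n => (isCompact_compactCovering X n).measurableSet) n)

instance : IsSFiniteKernel (lengthKernel (X := X)) := by
  unfold lengthKernel
  infer_instance

theorem lengthKernel_apply {F : Closeds X} (hF : HasLocallyFiniteLength F) :
    lengthKernel F = (Measure.hausdorffMeasure 1).restrict (F : Set X) := by
  have hm : ∀ n, MeasurableSet (compactCovering X n) :=
    fun n => (isCompact_compactCovering X n).measurableSet
  rw [lengthKernel, Kernel.sum_apply]
  simp only [Kernel.restrict_apply, lengthOnKernel_apply]
  have h (n : ℕ) : (lengthOn (compactCovering X n) F).restrict (disjointed (compactCovering X) n) =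
      (Measure.hausdorffMeasure 1).restrict ((F : Set X) ∩ disjointed (compactCovering X) n) := by
    rw [lengthOn_eq (hF n), Measure.restrict_restrict (MeasurableSet.disjointed hm n)]
    congr 1
    rw [← Set.inter_assoc, Set.inter_comm _ (F : Set X), Set.inter_assoc,
      Set.inter_eq_left.2 (disjointed_subset _ n)]
  simp only [h]
  rw [← Measure.restrict_iUnion, ← Set.inter_iUnion, iUnion_disjointed, iUnion_compactCovering,
    Set.inter_univ]
  · exact fun i j hij => ((disjoint_disjointed _) hij).mono Set.inter_subset_right
      Set.inter_subset_right
  · exact fun n => F.isClosed.measurableSet.inter (MeasurableSet.disjointed hm n)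

end Length

/-! ### Lines contained in a street system -/

section Lines

open Filter Topology

/-- The coordinates of the lines in `S` that are orthogonal to the `i`-th axis. -/
def lineCoords (i : Fin 2) (S : StreetSystem) : Set ℝ := {x | ∀ p : Plane, p i = x → p ∈ S}

theorem verticals_eq (S : StreetSystem) : verticals S = lineCoords 0 S := rfl

theorem horizontals_eq (S : StreetSystem) : horizontals S = lineCoords 1 S := rfl

theorem mem_of_mem_lineCoords {i : Fin 2} {S : StreetSystem} {p : Plane}
    (h : p i ∈ lineCoords i S) : p ∈ S := h p rfl

/-- The point with coordinate `x` in direction `i` and `y` in the other direction. -/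
def planePoint (i : Fin 2) (x y : ℝ) : Plane :=
  EuclideanSpace.single i x + EuclideanSpace.single (i + 1) y

theorem planePoint_apply (i : Fin 2) (x y : ℝ) : planePoint i x y i = x := by
  fin_cases i <;> simp [planePoint]

theorem eq_planePoint (i : Fin 2) (p : Plane) : p = planePoint i (p i) (p (i + 1)) := by
  ext j
  fin_cases i <;> fin_cases j <;> simp [planePoint]

theorem edist_planePoint_le (i : Fin 2) (x y x' y' : ℝ) :
    edist (planePoint i x y) (planePoint i x' y') ≤ edist x x' + edist y y' := by
  refine (edist_add_add_le _ _ _ _).trans ?_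
  exact add_le_add (PiLp.edist_single_same _ _ _ _ _).le (PiLp.edist_single_same _ _ _ _ _).le

theorem continuous_planePoint (i : Fin 2) (y : ℝ) : Continuous fun x => planePoint i x y := by
  refine continuous_iff_continuousAt.2 fun x => ?_
  refine tendsto_iff_edist_tendsto_0.2 ?_
  refine tendsto_of_tendsto_of_tendsto_of_le_of_le tendsto_const_nhds
    (tendsto_iff_edist_tendsto_0.1 (tendsto_id (x := 𝓝 x))) (fun _ => zero_le) fun x' => ?_
  simpa using edist_planePoint_le i x' y x y

theorem isClosed_lineCoords (i : Fin 2) (S : StreetSystem) : IsClosed (lineCoords i S) := by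
  have h : lineCoords i S = ⋂ y, (fun x => planePoint i x y) ⁻¹' S := by
    ext x
    simp only [Set.mem_iInter, Set.mem_preimage]
    refine ⟨fun hx y => hx _ (planePoint_apply i x y), fun hx p hp => ?_⟩
    rw [eq_planePoint i p, hp]
    exact hx _
  rw [h]
  exact isClosed_iInter fun y => S.isClosed.preimage (continuous_planePoint i y)

/-- `lineCoords` as a closed set. -/
def lineCloseds (i : Fin 2) (S : StreetSystem) : Closeds ℝ :=
  ⟨lineCoords i S, isClosed_lineCoords i S⟩

/-- A line lies in a closed set exactly if its points with rational second coordinate have distance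
zero. Compactness of `K` turns approximate lines with coordinates in `D` into a genuine one with
coordinate in `K`. -/
theorem measurable_lineCloseds (i : Fin 2) : Measurable (lineCloseds i) := by
  refine measurable_closeds_of_approx
    (fun x (n : ℕ) => {S | ∀ y : ℚ,
      Metric.infEDist (planePoint i x y) (S : Set Plane) ≤ (n + 1 : ℝ≥0∞)⁻¹})
    (fun x n => ?_) fun K hK D hDK _ hKD S => ?_
  · rw [Set.ofPred_forall]
    exact .iInter fun y => measurableSet_le (measurable_infEDist _) measurable_const
  constructor
  · rintro ⟨x₀, hx₀, hxK⟩ n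
    obtain ⟨x, hx, hxx⟩ := EMetric.mem_closure_iff.1 (hKD hxK) (n + 1 : ℝ≥0∞)⁻¹ (by simp)
    refine ⟨x, hx, fun y => ?_⟩
    refine (Metric.infEDist_le_edist_of_mem (hx₀ _ (planePoint_apply i x₀ y))).trans ?_
    refine (edist_planePoint_le _ _ _ _ _).trans ?_
    rw [edist_self, add_zero, edist_comm]
    exact hxx.le
  · intro H
    choose u huD hu using H
    obtain ⟨x, hxK, φ, hφ, hlim⟩ := hK.tendsto_subseq fun n => hDK (huD n)
    refine ⟨x, fun p hp => ?_, hxK⟩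
    refine (Metric.mem_iff_infEDist_zero_of_closed S.isClosed).2 ?_
    rw [eq_planePoint i p, hp]
    set y := p (i + 1)
    have hy (q : ℚ) : Metric.infEDist (planePoint i x q) (S : Set Plane) = 0 := by
      have h1 (n : ℕ) : Metric.infEDist (planePoint i x q) (S : Set Plane) ≤
          ((φ n : ℝ≥0∞) + 1)⁻¹ + edist ((u ∘ φ) n) x := by
        refine Metric.infEDist_le_infEDist_add_edist.trans
          (add_le_add (hu (φ n) q) ((edist_planePoint_le _ _ _ _ _).trans ?_))
        rw [edist_self, add_zero, edist_comm]
        rfl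
      have h2 : Tendsto (fun n : ℕ => ((φ n : ℝ≥0∞) + 1)⁻¹ + edist ((u ∘ φ) n) x) atTop
          (𝓝 (0 + 0)) := by
        refine Tendsto.add ?_ (tendsto_iff_edist_tendsto_0.1 hlim)
        have h3 : Tendsto (fun n : ℕ => ((n : ℝ≥0∞) + 1)⁻¹) atTop (𝓝 0) := by
          have := (tendsto_add_atTop_iff_nat 1).2 ENNReal.tendsto_inv_nat_nhds_zero
          simpa using this
        exact h3.comp hφ.tendsto_atTop
      rw [add_zero] at h2
      exact le_antisymm (ge_of_tendsto' h2 h1) zero_le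
    have hclosed : IsClosed {y : ℝ | Metric.infEDist (planePoint i x y) (S : Set Plane) = 0} := by
      refine isClosed_singleton.preimage (f := fun y : ℝ =>
        Metric.infEDist (planePoint i x y) (S : Set Plane)) (Metric.continuous_infEDist.comp ?_)
      have h4 : planePoint i x = fun y => planePoint (i + 1) y x := by
        funext y
        have hi : i + 1 + 1 = i := by fin_cases i <;> rfl
        unfold planePoint
        rw [hi, add_comm]
      rw [h4]
      exact continuous_planePoint (i + 1) x
    have : Set.range ((↑) : ℚ → ℝ) ⊆
        {y : ℝ | Metric.infEDist (planePoint i x y) (S : Set Plane) = 0} := by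
      rintro _ ⟨q, rfl⟩
      exact hy q
    have h5 := closure_minimal this hclosed
    rw [Rat.denseRange_cast.closure_range] at h5
    exact h5 (Set.mem_univ y)

theorem lineCoords_shift (i : Fin 2) (S : StreetSystem) (y : Plane) :
    lineCoords i (S.shift y) = {x | x + y i ∈ lineCoords i S} := by
  ext x
  constructor
  · intro h p hp
    have := h (p - y) (by simp [hp])
    rwa [mem_shift, sub_add_cancel] at this
  · intro h p hp
    exact h (p + y) (by simp [hp])

end Lines

/-! ### Counting points of closed subsets of the line -/

section Count

open Filter Topology

/-- Distinct points are separated by disjoint rational intervals. This expresses counting by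
countably many hitting conditions. -/
theorem le_encard_inter_iff {A B : Set ℝ} {m : ℕ} :
    (m : ℕ∞) ≤ (A ∩ B).encard ↔ ∃ u : Fin m → ℚ × ℚ,
      (Pairwise fun j k =>
        Disjoint (Set.Icc ((u j).1 : ℝ) (u j).2) (Set.Icc ((u k).1 : ℝ) (u k).2)) ∧
      ∀ j, (A ∩ (Set.Icc ((u j).1 : ℝ) (u j).2 ∩ B)).Nonempty := by
  constructor
  · intro h
    obtain ⟨s, hs, hcard⟩ := Set.exists_subset_encard_eq h
    have hfin : s.Finite := Set.finite_of_encard_eq_coe hcard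
    obtain ⟨U, hU, hdisj⟩ := hfin.t2_separation
    have hn : Nat.card s = m := by
      rw [Nat.card_coe_set_eq, Set.ncard, hcard]
      rfl
    have := hfin.to_subtype
    let e : Fin m ≃ s := (Finite.equivFinOfCardEq hn).symm
    have hq (x : ℝ) : ∃ q : ℚ × ℚ, x ∈ Set.Icc (q.1 : ℝ) q.2 ∧ Set.Icc (q.1 : ℝ) q.2 ⊆ U x := by
      obtain ⟨l, u, ⟨hl, hu⟩, hlu⟩ := mem_nhds_iff_exists_Ioo_subset.1 ((hU x).2.mem_nhds (hU x).1)
      obtain ⟨q, hq, hqx⟩ := exists_rat_btwn hl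
      obtain ⟨r, hxr, hr⟩ := exists_rat_btwn hu
      exact ⟨(q, r), ⟨hqx.le, hxr.le⟩, (Set.Icc_subset_Ioo hq hr).trans hlu⟩
    choose q hxq hqU using hq
    refine ⟨fun j => q (e j), fun j k hjk => ?_, fun j =>
      ⟨e j, (hs (e j).2).1, hxq _, (hs (e j).2).2⟩⟩
    refine (hdisj (e j).2 (e k).2 fun h => hjk (e.injective (Subtype.ext h))).mono ?_ ?_
    exacts [hqU _, hqU _]
  · rintro ⟨u, hdisj, hu⟩
    choose x hxA hxI hxB using hu
    have hinj : Function.Injective x := by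
      intro j k hjk
      by_contra hne
      exact Set.disjoint_left.1 (hdisj hne) (hxI j) (hjk ▸ hxI k)
    calc (m : ℕ∞) = (Set.range x).encard := by
          rw [← Set.image_univ, hinj.encard_image, Set.encard_univ]
          simp
      _ ≤ _ := Set.encard_le_encard (t := A ∩ B)
          (Set.range_subset_iff.2 fun j => ⟨hxA j, hxB j⟩)

theorem measurableSet_le_encard (a b : ℝ) (m : ℕ) :
    MeasurableSet {F : Closeds ℝ | (m : ℕ∞) ≤ ((F : Set ℝ) ∩ Set.Ioc a b).encard} := by
  simp only [le_encard_inter_iff, Set.ofPred_exists]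
  refine .iUnion fun u => ?_
  rw [Set.ofPred_and, Set.ofPred_forall]
  refine (MeasurableSet.const _).inter (.iInter fun j => ?_)
  have h : Set.Icc ((u j).1 : ℝ) (u j).2 ∩ Set.Ioc a b =
      ⋃ n : ℕ, Set.Icc ((u j).1 : ℝ) (u j).2 ∩ Set.Icc (a + ((n : ℝ) + 1)⁻¹) b := by
    ext x
    simp only [Set.mem_inter_iff, Set.mem_iUnion, Set.mem_Icc, Set.mem_Ioc]
    constructor
    · rintro ⟨hx, hax, hxb⟩
      obtain ⟨n, hn⟩ := exists_nat_one_div_lt (sub_pos.2 hax)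
      exact ⟨n, hx, by rw [one_div] at hn; linarith, hxb⟩
    · rintro ⟨n, hx, hax, hxb⟩
      have : (0 : ℝ) < ((n : ℝ) + 1)⁻¹ := by positivity
      exact ⟨hx, by linarith, hxb⟩
  rw [h]
  exact measurableSet_hits_iUnion fun n => isClosed_Icc.inter isClosed_Icc

theorem measurableSet_finite_inter_Ioc (a b : ℝ) :
    MeasurableSet {F : Closeds ℝ | ((F : Set ℝ) ∩ Set.Ioc a b).Finite} := by
  have h : {F : Closeds ℝ | ((F : Set ℝ) ∩ Set.Ioc a b).Finite} =
      ⋃ m : ℕ, {F : Closeds ℝ | (m : ℕ∞) ≤ ((F : Set ℝ) ∩ Set.Ioc a b).encard}ᶜ := by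
    ext F
    simp only [Set.mem_ofPred_eq, Set.mem_iUnion, Set.mem_compl_iff, not_le]
    rw [← Set.encard_lt_top_iff]
    constructor
    · intro h
      obtain ⟨n, hn⟩ := ENat.ne_top_iff_exists.1 h.ne
      exact ⟨n + 1, by rw [← hn]; exact_mod_cast Nat.lt_succ_self n⟩
    · rintro ⟨m, hm⟩
      exact hm.trans (ENat.natCast_lt_top m)
  rw [h]
  exact .iUnion fun m => (measurableSet_le_encard a b m).compl

/-- Since `ncard` is zero on infinite sets, the event of exceeding `m` also has to demand
finiteness. -/
theorem measurable_ncard_inter_Ioc (a b : ℝ) :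
    Measurable fun F : Closeds ℝ => ((F : Set ℝ) ∩ Set.Ioc a b).ncard := by
  refine measurable_of_Ioi fun m => ?_
  have h : (fun F : Closeds ℝ => ((F : Set ℝ) ∩ Set.Ioc a b).ncard) ⁻¹' Set.Ioi m =
      {F : Closeds ℝ | ((F : Set ℝ) ∩ Set.Ioc a b).Finite} ∩
        {F : Closeds ℝ | ((m + 1 : ℕ) : ℕ∞) ≤ ((F : Set ℝ) ∩ Set.Ioc a b).encard} := by
    ext F
    simp only [Set.mem_preimage, Set.mem_Ioi, Set.mem_inter_iff, Set.mem_ofPred_eq]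
    constructor
    · intro h
      have hfin := Set.finite_of_ncard_pos (lt_of_le_of_lt (Nat.zero_le m) h)
      refine ⟨hfin, ?_⟩
      rw [← hfin.cast_ncard_eq]
      exact_mod_cast h
    · rintro ⟨hfin, h⟩
      rw [← hfin.cast_ncard_eq] at h
      exact_mod_cast h
  rw [h]
  exact (measurableSet_finite_inter_Ioc a b).inter (measurableSet_le_encard a b (m + 1))

/-- Finiteness of the intersections with bounded intervals. -/
def LocallyFinite (A : Set ℝ) : Prop := ∀ a b, (A ∩ Set.Ioc a b).Finite

theorem measurableSet_locallyFinite :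
    MeasurableSet {F : Closeds ℝ | LocallyFinite (F : Set ℝ)} := by
  have h : {F : Closeds ℝ | LocallyFinite (F : Set ℝ)} =
      ⋂ n : ℕ, {F : Closeds ℝ | ((F : Set ℝ) ∩ Set.Ioc (-n : ℝ) n).Finite} := by
    ext F
    simp only [Set.mem_ofPred_eq, Set.mem_iInter]
    refine ⟨fun h n => h _ _, fun h a b => ?_⟩
    obtain ⟨n, hn⟩ := exists_nat_gt (max (-a) b)
    refine (h n).subset (Set.inter_subset_inter_right _ (Set.Ioc_subset_Ioc ?_ ?_))
    · linarith [le_max_left (-a) b]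
    · exact (le_max_right (-a) b).trans hn.le
  rw [h]
  exact .iInter fun n => measurableSet_finite_inter_Ioc _ _

variable {A : Set ℝ}

theorem ncard_inter_Ioc_of_le {a b : ℝ} (h : b ≤ a) : (A ∩ Set.Ioc a b).ncard = 0 := by
  simp [Set.Ioc_eq_empty_of_le h]

theorem LocallyFinite.ncard_add (hA : LocallyFinite A) {a b c : ℝ} (hab : a ≤ b) (hbc : b ≤ c) :
    (A ∩ Set.Ioc a b).ncard + (A ∩ Set.Ioc b c).ncard = (A ∩ Set.Ioc a c).ncard := by
  rw [← Set.ncard_union_eq _ (hA a b) (hA b c), ← Set.inter_union_distrib_left,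
    Set.Ioc_union_Ioc_eq_Ioc hab hbc]
  exact (Set.Ioc_disjoint_Ioc_of_le le_rfl).mono Set.inter_subset_right Set.inter_subset_right

/-- A difference of indices is a signed count between the two positions and no longer refers to the
origin; monotonicity and the behaviour under translation follow. Each ordering of `0`, `x`, `y`
reduces to additivity of counts. -/
theorem LocallyFinite.cellIndex_sub (hA : LocallyFinite A) (x y : ℝ) :
    cellIndex A x - cellIndex A y =
      ((A ∩ Set.Ioc y x).ncard : ℤ) - ((A ∩ Set.Ioc x y).ncard : ℤ) := by
  unfold cellIndex
  rcases le_total 0 x with h1 | h1 <;> rcases le_total 0 y with h2 | h2 <;>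
    rcases le_total x y with h3 | h3
  · rw [ncard_inter_Ioc_of_le h1, ncard_inter_Ioc_of_le h2, ncard_inter_Ioc_of_le h3,
      ← hA.ncard_add h1 h3]
    push_cast; ring
  · rw [ncard_inter_Ioc_of_le h1, ncard_inter_Ioc_of_le h2, ncard_inter_Ioc_of_le h3,
      ← hA.ncard_add h2 h3]
    push_cast; ring
  · have : x = 0 := le_antisymm (h3.trans h2) h1
    subst this
    simp
  · rw [ncard_inter_Ioc_of_le h1, ncard_inter_Ioc_of_le h2, ncard_inter_Ioc_of_le h3,
      ← hA.ncard_add h2 h1]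
    push_cast; ring
  · rw [ncard_inter_Ioc_of_le h1, ncard_inter_Ioc_of_le h2, ncard_inter_Ioc_of_le h3,
      ← hA.ncard_add h1 h2]
    push_cast; ring
  · have : x = 0 := le_antisymm h1 (h2.trans h3)
    subst this
    simp
  · rw [ncard_inter_Ioc_of_le h1, ncard_inter_Ioc_of_le h2, ncard_inter_Ioc_of_le h3,
      ← hA.ncard_add h3 h2]
    push_cast; ring
  · rw [ncard_inter_Ioc_of_le h1, ncard_inter_Ioc_of_le h2, ncard_inter_Ioc_of_le h3,
      ← hA.ncard_add h3 h1]
    push_cast; ring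

theorem LocallyFinite.cellIndex_mono (hA : LocallyFinite A) : Monotone (cellIndex A) := by
  intro x y hxy
  have := hA.cellIndex_sub y x
  rw [ncard_inter_Ioc_of_le hxy] at this
  omega

theorem LocallyFinite.cellIndex_eq (hA : LocallyFinite A) {x y : ℝ} (hxy : x ≤ y)
    (h : A ∩ Set.Icc x y = ∅) : cellIndex A x = cellIndex A y := by
  have h1 := hA.cellIndex_sub y x
  have h2 : A ∩ Set.Ioc x y = ∅ :=
    Set.subset_empty_iff.1 (h ▸ Set.inter_subset_inter_right _ Set.Ioc_subset_Icc_self)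
  rw [ncard_inter_Ioc_of_le hxy, h2, Set.ncard_empty] at h1
  omega

theorem ncard_preimage_add (a u v : ℝ) :
    ({x | x + a ∈ A} ∩ Set.Ioc u v).ncard = (A ∩ Set.Ioc (u + a) (v + a)).ncard := by
  rw [← Set.ncard_image_of_injective _ (add_left_injective a)]
  congr 1
  ext x
  constructor
  · rintro ⟨z, ⟨hz, h1, h2⟩, rfl⟩
    exact ⟨hz, add_lt_add_left h1 a, add_le_add_left h2 a⟩
  · rintro ⟨hx, h1, h2⟩
    exact ⟨x - a, ⟨by simpa using hx, by linarith, by linarith⟩, by simp⟩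

theorem LocallyFinite.preimage_add (hA : LocallyFinite A) (a : ℝ) :
    LocallyFinite {x | x + a ∈ A} := by
  intro u v
  refine ((hA (u + a) (v + a)).preimage (add_left_injective a).injOn).subset ?_
  rintro x ⟨hx, h1, h2⟩
  exact ⟨hx, add_lt_add_left h1 a, add_le_add_left h2 a⟩

theorem LocallyFinite.cellIndex_preimage_add (hA : LocallyFinite A) (a x : ℝ) :
    cellIndex {x | x + a ∈ A} x = cellIndex A (x + a) - cellIndex A a := by
  rw [hA.cellIndex_sub]
  unfold cellIndex
  rw [ncard_preimage_add, ncard_preimage_add, zero_add]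

theorem LocallyFinite.eventually_cellIndex_eq (hA : LocallyFinite A) {x : ℝ} (hx : x ∉ A) :
    ∀ᶠ y in 𝓝 x, cellIndex A y = cellIndex A x := by
  have hclosed : IsClosed (A ∩ Set.Ioc (x - 1) (x + 1)) := (hA _ _).isClosed
  have h1 : (A ∩ Set.Ioc (x - 1) (x + 1))ᶜ ∈ 𝓝 x := hclosed.isOpen_compl.mem_nhds fun h => hx h.1
  have h2 : Set.Ioo (x - 1) (x + 1) ∈ 𝓝 x := Ioo_mem_nhds (by linarith) (by linarith)
  obtain ⟨l, u, ⟨hl, hu⟩, hlu⟩ := mem_nhds_iff_exists_Ioo_subset.1 (inter_mem h1 h2)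
  have h3 (z : ℝ) (hz : z ∈ Set.Ioo l u) : z ∉ A := fun hzA =>
    (hlu hz).1 ⟨hzA, Set.Ioo_subset_Ioc_self (hlu hz).2⟩
  filter_upwards [Ioo_mem_nhds hl hu] with y hy
  rcases le_total x y with hxy | hxy
  · refine (hA.cellIndex_eq hxy ?_).symm
    refine Set.eq_empty_of_forall_notMem fun z hz => h3 z ⟨?_, ?_⟩ hz.1
    exacts [hl.trans_le hz.2.1, hz.2.2.trans_lt hy.2]
  · refine hA.cellIndex_eq hxy ?_
    refine Set.eq_empty_of_forall_notMem fun z hz => h3 z ⟨?_, ?_⟩ hz.1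
    exacts [hy.1.trans_le hz.2.1, hz.2.2.trans_lt hu]

end Count

/-! ### Nesting over street systems with locally finitely many lines -/

section Nest

open Filter Topology

/-- The lines contained in `S` are locally finite. -/
def HasLocallyFiniteLines (S : StreetSystem) : Prop := ∀ i, LocallyFinite (lineCoords i S)

theorem measurableSet_hasLocallyFiniteLines : MeasurableSet {S | HasLocallyFiniteLines S} := by
  have h : {S | HasLocallyFiniteLines S} =
      ⋂ i, lineCloseds i ⁻¹' {F : Closeds ℝ | LocallyFinite (F : Set ℝ)} := by
    ext S
    simp only [Set.mem_iInter]
    rfl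
  rw [h]
  exact .iInter fun i => measurable_lineCloseds i measurableSet_locallyFinite

theorem HasLocallyFiniteLines.shift {S : StreetSystem} (hS : HasLocallyFiniteLines S) (y : Plane) :
    HasLocallyFiniteLines (S.shift y) := fun i => by
  rw [lineCoords_shift]
  exact (hS i).preimage_add (y i)

theorem shift_shift (S : StreetSystem) (y z : Plane) : (S.shift y).shift z = S.shift (z + y) := by
  ext p
  change p + z + y ∈ S ↔ p + (z + y) ∈ S
  rw [add_assoc]

theorem measurable_blockIndex (p : Plane) : Measurable fun S => blockIndex S p := by
  have h (i : Fin 2) (x : ℝ) : Measurable fun S => cellIndex (lineCoords i S) x := by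
    have h1 (a b : ℝ) : Measurable fun S => ((lineCoords i S ∩ Set.Ioc a b).ncard : ℤ) :=
      (measurable_of_countable _).comp
        ((measurable_ncard_inter_Ioc a b).comp (measurable_lineCloseds i))
    exact (h1 0 x).sub (h1 x 0)
  exact (h 0 _).prodMk (h 1 _)

theorem HasLocallyFiniteLines.measurable_blockIndex {S : StreetSystem}
    (hS : HasLocallyFiniteLines S) : Measurable (blockIndex S) :=
  (((hS 0).cellIndex_mono.measurable).comp (by fun_prop)).prodMk
    (((hS 1).cellIndex_mono.measurable).comp (by fun_prop))

/-- Moving the origin to `y` only subtracts the label of the block of `y` from all labels. -/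
theorem HasLocallyFiniteLines.blockIndex_shift {S : StreetSystem} (hS : HasLocallyFiniteLines S)
    (y p : Plane) : blockIndex (S.shift y) p = blockIndex S (p + y) - blockIndex S y := by
  simp only [blockIndex, verticals_eq, horizontals_eq, lineCoords_shift,
    (hS _).cellIndex_preimage_add]
  rfl

theorem HasLocallyFiniteLines.eventually_blockIndex_eq {S : StreetSystem}
    (hS : HasLocallyFiniteLines S) {p : Plane} (hp : p ∉ S) :
    ∀ᶠ q in 𝓝 p, blockIndex S q = blockIndex S p := by
  have h (i : Fin 2) : ∀ᶠ q : Plane in 𝓝 p,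
      cellIndex (lineCoords i S) (q i) = cellIndex (lineCoords i S) (p i) :=
    (show Continuous fun q : Plane => q i by fun_prop).continuousAt.eventually
      ((hS i).eventually_cellIndex_eq fun hi => hp (mem_of_mem_lineCoords hi))
  filter_upwards [h 0, h 1] with q h0 h1
  exact Prod.ext h0 h1

theorem HasLocallyFiniteLines.finite_blockIndex {S : StreetSystem}
    (hS : HasLocallyFiniteLines S) : (blockIndex S '' unitSquare).Finite := by
  refine (Set.finite_Icc ((cellIndex (lineCoords 0 S) 0, cellIndex (lineCoords 1 S) 0) : ℤ × ℤ)
    (cellIndex (lineCoords 0 S) 1, cellIndex (lineCoords 1 S) 1)).subset ?_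
  rintro _ ⟨p, hp, rfl⟩
  exact ⟨⟨(hS 0).cellIndex_mono (hp 0).1, (hS 1).cellIndex_mono (hp 1).1⟩,
    ⟨(hS 0).cellIndex_mono (hp 0).2, (hS 1).cellIndex_mono (hp 1).2⟩⟩

/-- The block index is locally constant off `S`, so the union is already closed and the closure in
`nest` adds nothing. -/
theorem HasLocallyFiniteLines.coe_nest {S : StreetSystem} (hS : HasLocallyFiniteLines S)
    (T : ℤ × ℤ → StreetSystem) :
    (nest S T : Set Plane) = (S : Set Plane) ∪ {p | p ∈ T (blockIndex S p)} := by
  refine IsClosed.closure_eq (isOpen_compl_iff.1 (isOpen_iff_mem_nhds.2 fun p hp => ?_))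
  have hpS : p ∉ S := fun h => hp (Or.inl h)
  have hpT : p ∉ T (blockIndex S p) := fun h => hp (Or.inr h)
  filter_upwards [hS.eventually_blockIndex_eq hpS, S.isClosed.isOpen_compl.mem_nhds hpS,
    (T (blockIndex S p)).isClosed.isOpen_compl.mem_nhds hpT] with q hq hqS hqT
  rintro (h | h)
  · exact hqS h
  · rw [Set.mem_ofPred_eq, hq] at h
    exact hqT h

theorem HasLocallyFiniteLines.mem_nest {S : StreetSystem} (hS : HasLocallyFiniteLines S)
    {T : ℤ × ℤ → StreetSystem} {p : Plane} : p ∈ nest S T ↔ p ∈ S ∨ p ∈ T (blockIndex S p) := by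
  rw [← SetLike.mem_coe, hS.coe_nest T]
  rfl

/-- This is the algebraic core of the theorem: a nested system seen from `y` is nested again, and
the block of `y` receives the label zero. -/
theorem HasLocallyFiniteLines.nest_shift {S : StreetSystem} (hS : HasLocallyFiniteLines S)
    (T : ℤ × ℤ → StreetSystem) (y : Plane) :
    (nest S T).shift y = nest (S.shift y) fun j => (T (j + blockIndex S y)).shift y := by
  ext p
  change p + y ∈ nest S T ↔ p ∈ nest (S.shift y) _
  rw [hS.mem_nest, (hS.shift y).mem_nest, hS.blockIndex_shift, sub_add_cancel]
  rfl

/-! ### Measurability of nesting -/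

/-- The closed rectangle with the given projections to the axes. -/
def box (q : Fin 2 → ℚ × ℚ) : Set Plane := {p | ∀ i, p i ∈ Set.Icc ((q i).1 : ℝ) (q i).2}

theorem isClosed_box (q : Fin 2 → ℚ × ℚ) : IsClosed (box q) := by
  have : box q = ⋂ i, (fun p : Plane => p i) ⁻¹' Set.Icc ((q i).1 : ℝ) (q i).2 := by
    ext p
    simp [box]
  rw [this]
  exact isClosed_iInter fun i => isClosed_Icc.preimage (by fun_prop)

/-- The lower left corner of a rectangle. -/
def corner (q : Fin 2 → ℚ × ℚ) : Plane := WithLp.toLp 2 fun i => ((q i).1 : ℝ)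

/-- A rectangle whose projections avoid the line coordinates lies in one block. Its rational corner
then identifies the block through countably many possible points. -/
theorem HasLocallyFiniteLines.blockIndex_corner {S : StreetSystem} (hS : HasLocallyFiniteLines S)
    {q : Fin 2 → ℚ × ℚ} (hq : ∀ i, lineCoords i S ∩ Set.Icc ((q i).1 : ℝ) (q i).2 = ∅)
    {p : Plane} (hp : p ∈ box q) : blockIndex S (corner q) = blockIndex S p := by
  have h (i : Fin 2) : cellIndex (lineCoords i S) (corner q i) = cellIndex (lineCoords i S) (p i) :=
    (hS i).cellIndex_eq (hp i).1 (Set.subset_empty_iff.1 ((hq i) ▸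
      Set.inter_subset_inter_right _ (Set.Icc_subset_Icc le_rfl (hp i).2)))
  exact Prod.ext (h 0) (h 1)

theorem LocallyFinite.exists_Icc {A : Set ℝ} (hA : LocallyFinite A) {x : ℝ} (hx : x ∉ A) :
    ∃ q : ℚ × ℚ, x ∈ Set.Icc (q.1 : ℝ) q.2 ∧ A ∩ Set.Icc (q.1 : ℝ) q.2 = ∅ := by
  have h1 : (A ∩ Set.Ioc (x - 1) (x + 1))ᶜ ∩ Set.Ioo (x - 1) (x + 1) ∈ 𝓝 x :=
    inter_mem ((hA _ _).isClosed.isOpen_compl.mem_nhds fun h => hx h.1)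
      (Ioo_mem_nhds (by linarith) (by linarith))
  obtain ⟨l, u, ⟨hl, hu⟩, hlu⟩ := mem_nhds_iff_exists_Ioo_subset.1 h1
  obtain ⟨q, hq, hqx⟩ := exists_rat_btwn hl
  obtain ⟨r, hxr, hr⟩ := exists_rat_btwn hu
  refine ⟨(q, r), ⟨hqx.le, hxr.le⟩, Set.eq_empty_of_forall_notMem fun z hz => ?_⟩
  have := hlu ⟨hq.trans_le hz.2.1, hz.2.2.trans_lt hr⟩
  exact this.1 ⟨hz.1, Set.Ioo_subset_Ioc_self this.2⟩

/-- A point off `S` has a rational rectangle around it that no line of `S` enters, so hitting by a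
side street decomposes into countably many events with a fixed rectangle and a fixed label. -/
theorem HasLocallyFiniteLines.nest_hits_iff {S : StreetSystem} (hS : HasLocallyFiniteLines S)
    {T : ℤ × ℤ → StreetSystem} {K : Set Plane} :
    ((nest S T : Set Plane) ∩ K).Nonempty ↔ ((S : Set Plane) ∩ K).Nonempty ∨
      ∃ (q : Fin 2 → ℚ × ℚ) (j : ℤ × ℤ),
        (∀ i, lineCoords i S ∩ Set.Icc ((q i).1 : ℝ) (q i).2 = ∅) ∧ blockIndex S (corner q) = j ∧
          ((T j : Set Plane) ∩ (K ∩ box q)).Nonempty := by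
  constructor
  · rintro ⟨p, hp, hpK⟩
    by_cases hpS : p ∈ S
    · exact .inl ⟨p, hpS, hpK⟩
    · have hpT := (hS.mem_nest.1 hp).resolve_left hpS
      choose q hpq hq using fun i =>
        (hS i).exists_Icc fun hi : p i ∈ lineCoords i S => hpS (mem_of_mem_lineCoords hi)
      exact .inr ⟨q, _, hq, hS.blockIndex_corner hq hpq, p, hpT, hpK, hpq⟩
  · rintro (⟨p, hp, hpK⟩ | ⟨q, j, hq, rfl, p, hpT, hpK, hpq⟩)
    · exact ⟨p, hS.mem_nest.2 (.inl hp), hpK⟩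
    · refine ⟨p, hS.mem_nest.2 (.inr ?_), hpK⟩
      rwa [← hS.blockIndex_corner hq hpq]

open Classical in
/-- A measurable version of `nest`. -/
def nestM (q : StreetSystem × (ℤ × ℤ → StreetSystem)) : StreetSystem :=
  if HasLocallyFiniteLines q.1 then nest q.1 q.2 else ⊥

theorem HasLocallyFiniteLines.nestM_eq {S : StreetSystem} (hS : HasLocallyFiniteLines S)
    (T : ℤ × ℤ → StreetSystem) : nestM (S, T) = nest S T := if_pos hS

theorem measurable_nestM : Measurable nestM := by
  refine measurable_generateFrom ?_
  rintro _ ⟨K, hK, rfl⟩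
  have h : nestM ⁻¹' {F : StreetSystem | ((F : Set Plane) ∩ K).Nonempty} =
      Prod.fst ⁻¹' {S | HasLocallyFiniteLines S} ∩
        (Prod.fst ⁻¹' {S | ((S : Set Plane) ∩ K).Nonempty} ∪
          ⋃ (q : Fin 2 → ℚ × ℚ) (j : ℤ × ℤ),
            (Prod.fst ⁻¹' (⋂ i, lineCloseds i ⁻¹'
              {F : Closeds ℝ | ((F : Set ℝ) ∩ Set.Icc ((q i).1 : ℝ) (q i).2).Nonempty}ᶜ) ∩
            Prod.fst ⁻¹' ((fun S => blockIndex S (corner q)) ⁻¹' {j})) ∩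
            (fun r : StreetSystem × (ℤ × ℤ → StreetSystem) => r.2 j) ⁻¹'
              {T : StreetSystem | ((T : Set Plane) ∩ (K ∩ box q)).Nonempty}) := by
    ext ⟨S, T⟩
    by_cases hS : HasLocallyFiniteLines S
    · simp only [Set.mem_preimage, Set.mem_ofPred_eq, hS.nestM_eq, hS.nest_hits_iff,
        Set.mem_inter_iff, hS, true_and, Set.mem_union, Set.mem_iUnion, Set.mem_iInter,
        Set.mem_compl_iff, Set.not_nonempty_iff_eq_empty, Set.mem_singleton_iff, and_assoc]
      rfl
    · simp [nestM, hS]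
  rw [h]
  refine (measurable_fst measurableSet_hasLocallyFiniteLines).inter
    ((measurable_fst (measurableSet_hits_compact hK)).union
      (.iUnion fun q => .iUnion fun j => (MeasurableSet.inter ?_ ?_).inter ?_))
  · refine measurable_fst (.iInter fun i => measurable_lineCloseds i ?_)
    exact (measurableSet_hits_compact isCompact_Icc).compl
  · exact measurable_fst (measurable_blockIndex _ (measurableSet_singleton j))
  · have hj : Measurable fun r : StreetSystem × (ℤ × ℤ → StreetSystem) => r.2 j :=
      (measurable_pi_apply j).comp measurable_snd
    exact hj (measurableSet_hits_compact (hK.inter_right (isClosed_box q)))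

end Nest

/-! ### Stationary street systems and the refined Campbell formula -/

section Campbell

open Filter Topology

theorem unitSquare_eq_preimage :
    unitSquare = (fun p : Plane => (p : Fin 2 → ℝ)) ⁻¹' Set.pi Set.univ fun _ => Set.Icc 0 1 := by
  ext p
  simp only [unitSquare, Set.mem_preimage, Set.mem_pi, Set.mem_univ, true_imp_iff]
  rfl

theorem isClosed_unitSquare : IsClosed unitSquare := by
  rw [unitSquare_eq_preimage]
  exact (isClosed_set_pi fun _ _ => isClosed_Icc).preimage (PiLp.continuous_ofLp 2 _)

theorem isCompact_unitSquare : IsCompact unitSquare := by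
  rw [unitSquare_eq_preimage]
  exact (PiLp.homeomorph 2 _).isCompact_preimage.2 (isCompact_univ_pi fun _ => isCompact_Icc)

theorem isCompact_translate_unitSquare (z : Plane) :
    IsCompact {p : Plane | p - z ∈ unitSquare} :=
  (Homeomorph.subRight z).isCompact_preimage.2 isCompact_unitSquare

theorem volume_unitSquare : volume unitSquare = 1 := by
  rw [unitSquare_eq_preimage, (PiLp.volume_preserving_ofLp (Fin 2)).measure_preimage
    (MeasurableSet.univ_pi fun _ => measurableSet_Icc).nullMeasurableSet, volume_pi_pi]
  simp

theorem lintegral_hausdorffMeasure_add_right (r : StreetSystem) (z : Plane)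
    (g : Plane → ℝ≥0∞) :
    ∫⁻ y in r, g (y + z) ∂Measure.hausdorffMeasure 1 =
      ∫⁻ y in r.shift (-z), g y ∂Measure.hausdorffMeasure 1 := by
  have h := (IsometryEquiv.addRight z).measurePreserving_hausdorffMeasure 1
  have h2 := h.setLIntegral_comp_preimage_emb
    (IsometryEquiv.addRight z).toHomeomorph.measurableEmbedding g (r.shift (-z))
  rw [← h2]
  congr 2
  ext p
  change p ∈ r ↔ p + z + -z ∈ r
  rw [add_neg_cancel_right]

/-- Invariance of the law of a street system under all translations. -/
def IsStationary (τ : Measure StreetSystem) : Prop := ∀ y, τ.map (fun r => r.shift y) = τ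

theorem measurable_shift_const (y : Plane) : Measurable fun r : StreetSystem => r.shift y :=
  measurable_shift.comp (measurable_id.prodMk measurable_const)

theorem measurable_shift_left (r : StreetSystem) : Measurable fun y : Plane => r.shift y :=
  measurable_shift.comp (measurable_const.prodMk measurable_id)

variable {τ π : Measure StreetSystem}

theorem IsStationary.measurePreserving (hτ : IsStationary τ) (y : Plane) :
    MeasurePreserving (fun r : StreetSystem => r.shift y) τ τ :=
  ⟨measurable_shift_const y, hτ y⟩

theorem hausdorffMeasure_inter_shift (r : StreetSystem) (z : Plane) (B : Set Plane) :
    Measure.hausdorffMeasure 1 ((r.shift z : Set Plane) ∩ B) =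
      Measure.hausdorffMeasure 1 ((r : Set Plane) ∩ {p | p - z ∈ B}) := by
  rw [← (IsometryEquiv.addRight z).hausdorffMeasure_preimage 1 ((r : Set Plane) ∩ {p | p - z ∈ B})]
  congr 1
  ext p
  change _ ↔ p + z ∈ r ∧ p + z - z ∈ B
  rw [add_sub_cancel_right]
  rfl

theorem IsStationary.lintegral_length_translate (hτ : IsStationary τ) (z : Plane) :
    ∫⁻ r : StreetSystem,
        Measure.hausdorffMeasure 1 ((r : Set Plane) ∩ {p | p - z ∈ unitSquare}) ∂τ =
      intensity τ id := by
  simp_rw [← hausdorffMeasure_inter_shift]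
  exact (hτ.measurePreserving z).lintegral_comp (measurable_length_inter isCompact_unitSquare)

theorem translate_unitSquare_mem_nhds (x : Plane) :
    {p | p - (x - WithLp.toLp 2 fun _ => (1 / 2 : ℝ)) ∈ unitSquare} ∈ 𝓝 x := by
  have h : ∀ i : Fin 2, ∀ᶠ p : Plane in 𝓝 x, p i ∈ Set.Ioo (x i - 1 / 2) (x i + 1 / 2) := fun i =>
    (show Continuous fun q : Plane => q i by fun_prop).continuousAt.eventually
      (Ioo_mem_nhds (by linarith) (by linarith))
  filter_upwards [eventually_all.2 h] with p hp i
  change p i - (x i - 1 / 2) ∈ Set.Icc (0 : ℝ) 1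
  exact ⟨by linarith [(hp i).1], by linarith [(hp i).2]⟩

/-- Every point has a translate of the unit square as a neighbourhood, stationarity gives it the
same finite mean length, and compact sets need only finitely many of these. -/
theorem IsStationary.ae_hasLocallyFiniteLength (hτ : IsStationary τ)
    (hγ : intensity τ id ≠ ∞) : ∀ᵐ r ∂τ, HasLocallyFiniteLength r := by
  refine ae_all_iff.2 fun n => ?_
  refine (isCompact_compactCovering Plane n).induction_on
    (p := fun s => ∀ᵐ r : StreetSystem ∂τ, Measure.hausdorffMeasure 1 ((r : Set Plane) ∩ s) < ∞)
    (by simp) ?_ ?_ ?_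
  · intro s t hst ht
    filter_upwards [ht] with r hr
    exact (measure_mono (Set.inter_subset_inter_right _ hst)).trans_lt hr
  · intro s t hs ht
    filter_upwards [hs, ht] with r hrs hrt
    rw [Set.inter_union_distrib_left]
    exact (measure_union_le _ _).trans_lt (ENNReal.add_lt_top.2 ⟨hrs, hrt⟩)
  · intro x _
    refine ⟨_, mem_nhdsWithin_of_mem_nhds (translate_unitSquare_mem_nhds x), ?_⟩
    refine ae_lt_top (measurable_length_inter ?_) ?_
    · exact isCompact_translate_unitSquare _
    · rw [hτ.lintegral_length_translate]
      exact hγ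

/-- The mean measure of the pairs `(y, r - y)` with `y` in `r` distributed according to length. -/
def campbellMeasure (τ : Measure StreetSystem) : Measure (Plane × StreetSystem) :=
  (τ ⊗ₘ lengthKernel).map fun q => (q.2, q.1.shift q.2)

theorem lintegral_campbellMeasure [SFinite τ] (h : ∀ᵐ r ∂τ, HasLocallyFiniteLength r)
    {g : Plane × StreetSystem → ℝ≥0∞} (hg : Measurable g) :
    ∫⁻ q, g q ∂campbellMeasure τ =
      ∫⁻ r, ∫⁻ y in (r : Set Plane), g (y, r.shift y) ∂Measure.hausdorffMeasure 1 ∂τ := by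
  have hm : Measurable fun q : StreetSystem × Plane => (q.2, q.1.shift q.2) :=
    measurable_snd.prodMk measurable_shift
  rw [campbellMeasure, lintegral_map hg hm,
    Measure.lintegral_compProd (f := fun q : StreetSystem × Plane => g (q.2, q.1.shift q.2))
      (hg.comp hm)]
  refine lintegral_congr_ae ?_
  filter_upwards [h] with r hr
  rw [lengthKernel_apply hr]

/-- Moving the point by `z` while keeping the view from it is the same as translating the whole
system, which leaves its law unchanged. -/
theorem IsStationary.campbellMeasure_map_add [SFinite τ] (hτ : IsStationary τ)
    (h : ∀ᵐ r ∂τ, HasLocallyFiniteLength r) (z : Plane) :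
    (campbellMeasure τ).map (fun q => (z + q.1, q.2)) = campbellMeasure τ := by
  have hm : Measurable fun q : Plane × StreetSystem => (z + q.1, q.2) := by fun_prop
  refine Measure.ext_of_lintegral _ fun g hg => ?_
  rw [lintegral_map hg hm,
    lintegral_campbellMeasure h (g := fun q => g (z + q.1, q.2)) (hg.comp hm),
    lintegral_campbellMeasure h hg]
  let Ψ : StreetSystem → ℝ≥0∞ := fun r => ∫⁻ y, g (y, r.shift y) ∂lengthKernel r
  have hΨ : Measurable Ψ := Measurable.lintegral_kernel_prod_right'
    (f := fun q : StreetSystem × Plane => g (q.2, q.1.shift q.2))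
    (hg.comp (measurable_snd.prodMk measurable_shift))
  have h' := (hτ.measurePreserving (-z)).quasiMeasurePreserving.ae h
  calc _ = ∫⁻ r : StreetSystem, Ψ (r.shift (-z)) ∂τ := by
        refine lintegral_congr_ae ?_
        filter_upwards [h'] with r hr
        simp only [Ψ]
        rw [lengthKernel_apply hr, ← lintegral_hausdorffMeasure_add_right]
        simp only [shift_shift, add_neg_cancel_right, add_comm z]
    _ = ∫⁻ r, Ψ r ∂τ := (hτ.measurePreserving (-z)).lintegral_comp hΨ
    _ = _ := by
        refine lintegral_congr_ae ?_
        filter_upwards [h] with r hr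
        simp only [Ψ]
        rw [lengthKernel_apply hr]

/-- The test function `1` gives `1 = γ⁻¹ * γ`, which fails in `ℝ≥0∞` for `γ = 0` and `γ = ∞`.
Positivity and finiteness of intensities thus come from the existence of Palm versions. -/
theorem IsPalmVersion.intensity_ne {Ω Ω' : Type*} [MeasurableSpace Ω] [MeasurableSpace Ω']
    {P : Measure Ω} {S : Ω → StreetSystem} {P' : Measure Ω'} {S' : Ω' → StreetSystem}
    (h : IsPalmVersion P S P' S') [IsProbabilityMeasure P'] :
    intensity P S ≠ 0 ∧ intensity P S ≠ ∞ := by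
  have h := h.2 (fun _ => 1) measurable_const
  simp only [lintegral_const, measure_univ, Measure.restrict_apply .univ, Set.univ_inter,
    one_mul] at h
  change 1 = (intensity P S)⁻¹ * intensity P S at h
  constructor <;> intro h0 <;> simp [h0] at h

theorem measurable_lintegral_lengthOn {g : StreetSystem × Plane → ℝ≥0∞} (hg : Measurable g)
    {K : Set Plane} (hK : IsCompact K) :
    Measurable fun r => ∫⁻ y, g (r, y) ∂lengthOn K r :=
  Measurable.lintegral_kernel_prod_right' (κ := lengthOnKernel hK) hg

/-- For fixed `A`, the first marginal of the part over `A` is translation invariant and locally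
finite, hence a multiple of Lebesgue measure. The Palm property gives the factor, as the value on
the unit square. -/
theorem IsPalmVersion.campbellMeasure_eq [IsProbabilityMeasure τ] [IsProbabilityMeasure π]
    (hτ : IsStationary τ) (hπ : IsPalmVersion τ id π id) :
    campbellMeasure τ = volume.prod (intensity τ id • π) := by
  obtain ⟨h0, ht⟩ := hπ.intensity_ne
  have hlf := hτ.ae_hasLocallyFiniteLength ht
  have : IsFiniteMeasure (intensity τ id • π) := Measure.smul_finite _ ht
  symm
  refine Measure.prod_eq fun B A hB hA => ?_
  let M : Measure Plane := ((campbellMeasure τ).restrict (Prod.snd ⁻¹' A)).map Prod.fst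
  have hM {B : Set Plane} (hB : MeasurableSet B) : M B = campbellMeasure τ (B ×ˢ A) := by
    rw [Measure.map_apply measurable_fst hB, Measure.restrict_apply (measurable_fst hB)]
    rfl
  have hM' {B : Set Plane} (hB : MeasurableSet B) :
      M B = ∫⁻ r, ∫⁻ y in (r : Set Plane) ∩ B, A.indicator 1 (r.shift y)
        ∂Measure.hausdorffMeasure 1 ∂τ := by
    rw [hM hB, ← lintegral_indicator_one (hB.prod hA), lintegral_campbellMeasure hlf
      (measurable_one.indicator (hB.prod hA))]
    refine lintegral_congr fun r => ?_
    rw [Set.inter_comm, ← Measure.restrict_restrict hB, ← lintegral_indicator hB]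
    refine lintegral_congr fun y => ?_
    by_cases hy : y ∈ B
    · by_cases ha : r.shift y ∈ A
      · rw [Set.indicator_of_mem (show (y, r.shift y) ∈ B ×ˢ A from ⟨hy, ha⟩),
          Set.indicator_of_mem hy, Set.indicator_of_mem ha]
        rfl
      · rw [Set.indicator_of_notMem (show (y, r.shift y) ∉ B ×ˢ A from fun h => ha h.2),
          Set.indicator_of_mem hy, Set.indicator_of_notMem ha]
    · rw [Set.indicator_of_notMem (show (y, r.shift y) ∉ B ×ˢ A from fun h => hy h.1),
        Set.indicator_of_notMem hy]
  have hMQ : M unitSquare = intensity τ id * π A := by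
    have h2 := hπ.2 (A.indicator 1) (measurable_one.indicator hA)
    simp only [id] at h2
    rw [lintegral_indicator_one hA] at h2
    rw [h2, ← mul_assoc, ENNReal.mul_inv_cancel h0 ht, one_mul,
      hM' isClosed_unitSquare.measurableSet]
  have hinv : M.IsAddLeftInvariant := by
    refine ⟨fun z => ?_⟩
    ext B hB
    rw [Measure.map_apply (measurable_const_add z) hB, hM hB, hM (measurable_const_add z hB)]
    conv_rhs => rw [← hτ.campbellMeasure_map_add hlf z]
    rw [Measure.map_apply (by fun_prop) (hB.prod hA)]
    rfl
  have hloc : IsLocallyFiniteMeasure M := by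
    refine ⟨fun x => ⟨_, translate_unitSquare_mem_nhds x, ?_⟩⟩
    rw [hM' (isCompact_translate_unitSquare _).measurableSet]
    refine lt_of_le_of_lt (lintegral_mono fun r => ?_)
      ((hτ.lintegral_length_translate
        (x - WithLp.toLp 2 fun _ => (1 / 2 : ℝ))).trans_lt ht.lt_top)
    refine (lintegral_mono (g := fun _ => 1) fun y => ?_).trans (by simp)
    exact Set.indicator_le_self' (fun _ _ => zero_le) _
  have hvol := Measure.isAddLeftInvariant_eq_smul M volume
  have hc : (Measure.addHaarScalarFactor M volume : ℝ≥0∞) = intensity τ id * π A := by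
    rw [← hMQ]
    conv_rhs => rw [hvol]
    rw [Measure.smul_apply, volume_unitSquare]
    simp [ENNReal.smul_def]
  rw [← hM hB, hvol, Measure.smul_apply, ENNReal.smul_def, hc, smul_eq_mul, mul_comm]
  rfl

/-- The refined Campbell formula. -/
theorem IsPalmVersion.lintegral_eq [IsProbabilityMeasure τ] [IsProbabilityMeasure π]
    (hτ : IsStationary τ) (hπ : IsPalmVersion τ id π id)
    {g : Plane × StreetSystem → ℝ≥0∞} (hg : Measurable g) :
    ∫⁻ r, ∫⁻ y in (r : Set Plane), g (y, r.shift y) ∂Measure.hausdorffMeasure 1 ∂τ =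
      intensity τ id * ∫⁻ y, ∫⁻ s, g (y, s) ∂π := by
  obtain ⟨h0, ht⟩ := hπ.intensity_ne
  have : IsFiniteMeasure (intensity τ id • π) := Measure.smul_finite _ ht
  rw [← lintegral_campbellMeasure (hτ.ae_hasLocallyFiniteLength ht) hg, hπ.campbellMeasure_eq hτ,
    lintegral_prod _ hg.aemeasurable, ← lintegral_const_mul _ hg.lintegral_prod_right']
  simp [lintegral_smul_measure]

/-- A fixed set of area zero almost surely meets a stationary street system in a set of length
zero. -/
theorem IsPalmVersion.ae_length_inter_eq_zero [IsProbabilityMeasure τ] [IsProbabilityMeasure π]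
    (hτ : IsStationary τ) (hπ : IsPalmVersion τ id π id) {B : Set Plane} (hB : IsCompact B)
    (h : volume B = 0) :
    ∀ᵐ r : StreetSystem ∂τ, Measure.hausdorffMeasure 1 ((r : Set Plane) ∩ B) = 0 := by
  refine (lintegral_eq_zero_iff (measurable_length_inter hB)).1 ?_
  have hg : Measurable fun q : Plane × StreetSystem => B.indicator (1 : Plane → ℝ≥0∞) q.1 :=
    (measurable_one.indicator hB.measurableSet).comp measurable_fst
  -- The test function depends on the position only.
  have h2 := hπ.lintegral_eq hτ hg
  simp only [lintegral_const, measure_univ, mul_one, lintegral_indicator_one hB.measurableSet, h,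
    mul_zero] at h2
  rw [← h2]
  refine lintegral_congr fun r => ?_
  rw [Measure.restrict_apply hB.measurableSet, Set.inter_comm]

/-- Finite one-dimensional measure forces two-dimensional Hausdorff measure zero, and Lebesgue
measure is a multiple of the latter by uniqueness of Haar measure. -/
theorem volume_eq_zero_of_length_lt_top {B : Set Plane}
    (h : Measure.hausdorffMeasure 1 B < ∞) : volume B = 0 := by
  have h2 : Measure.hausdorffMeasure 2 B = 0 :=
    (Measure.hausdorffMeasure_zero_or_top (by norm_num : (1 : ℝ) < 2) B).resolve_right h.ne
  have : (Measure.hausdorffMeasure (2 : ℝ) : Measure Plane).IsAddHaarMeasure := by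
    have h3 := isAddHaarMeasure_hausdorffMeasure (E := Plane)
    rw [finrank_euclideanSpace_fin] at h3
    exact_mod_cast h3
  rw [Measure.isAddLeftInvariant_eq_smul volume (Measure.hausdorffMeasure (2 : ℝ)),
    Measure.smul_apply, h2, smul_zero]

end Campbell

/-! ### Infinite product measures -/

section InfinitePi

variable {ι : Type*} [DecidableEq ι] {X : ι → Type*} [∀ i, MeasurableSpace (X i)]
  (μ : ∀ i, Measure (X i)) [∀ i, IsProbabilityMeasure (μ i)]

/-- Resampling one coordinate does not change a product measure. -/
theorem map_update_infinitePi (i : ι) :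
    ((Measure.infinitePi μ).prod (μ i)).map (fun q => Function.update q.1 i q.2) =
      Measure.infinitePi μ := by
  have hm : Measurable fun q : (∀ j, X j) × X i => Function.update q.1 i q.2 :=
    measurable_update'
  refine Measure.eq_infinitePi _ fun s t ht => ?_
  rw [Measure.map_apply hm (.pi s.countable_toSet fun j _ => ht j)]
  have h : (fun q : (∀ j, X j) × X i => Function.update q.1 i q.2) ⁻¹' (Set.pi s t) =
      (Set.pi (s.erase i : Finset ι) t) ×ˢ (if i ∈ s then t i else Set.univ) := by
    ext ⟨x, r⟩
    simp only [Set.mem_preimage, Set.mem_pi, Set.mem_prod, Finset.mem_coe, Finset.mem_erase]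
    constructor
    · intro h
      refine ⟨fun j hj => by simpa [hj.1] using h j hj.2, ?_⟩
      split_ifs with hi
      · simpa using h i hi
      · trivial
    · rintro ⟨h, hr⟩ j hj
      rcases eq_or_ne j i with rfl | hji
      · simpa [hj] using hr
      · simpa [hji] using h j ⟨hji, hj⟩
  rw [h, Measure.prod_prod, Measure.infinitePi_pi _ fun j _ => ht j]
  split_ifs with hi
  · rw [mul_comm, Finset.mul_prod_erase s (fun j => μ j (t j)) hi]
  · rw [measure_univ, mul_one, Finset.erase_eq_of_notMem hi]

theorem lintegral_infinitePi_update (i : ι) {f : (∀ j, X j) → ℝ≥0∞} (hf : Measurable f) :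
    ∫⁻ x, f x ∂Measure.infinitePi μ =
      ∫⁻ r, ∫⁻ x, f (Function.update x i r) ∂Measure.infinitePi μ ∂μ i := by
  have hm : Measurable fun q : (∀ j, X j) × X i => Function.update q.1 i q.2 :=
    measurable_update'
  conv_lhs => rw [← map_update_infinitePi μ i]
  rw [lintegral_map hf hm]
  exact lintegral_prod_symm' _ (hf.comp hm)

/-- A coordinate is independent of a function of the other coordinates. -/
theorem map_eval_prod_infinitePi {Y : Type*} [MeasurableSpace Y] (i : ι) {g : (∀ j, X j) → Y}
    (hg : Measurable g) (h : ∀ x r, g (Function.update x i r) = g x) :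
    (Measure.infinitePi μ).map (fun x => (x i, g x)) =
      (μ i).prod ((Measure.infinitePi μ).map g) := by
  have : IsProbabilityMeasure ((Measure.infinitePi μ).map g) :=
    Measure.isProbabilityMeasure_map hg.aemeasurable
  have hm : Measurable fun x : ∀ j, X j => (x i, g x) := (measurable_pi_apply i).prodMk hg
  refine (Measure.prod_eq fun s t hs ht => ?_).symm
  rw [Measure.map_apply hm (hs.prod ht), Measure.map_apply hg ht]
  -- Resampling turns coordinate `i` into a separate factor and does not affect `g`.
  conv_lhs => rw [← map_update_infinitePi μ i]
  rw [Measure.map_apply measurable_update' (hm (hs.prod ht))]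
  have h2 : (fun q : (∀ j, X j) × X i => Function.update q.1 i q.2) ⁻¹'
      ((fun x => (x i, g x)) ⁻¹' s ×ˢ t) = (g ⁻¹' t) ×ˢ s := by
    ext ⟨x, r⟩
    simp [h, and_comm]
  rw [h2, Measure.prod_prod, mul_comm]

end InfinitePi

/-- Relabelling preserves an iid family, and a common translation preserves each stationary law.
This absorbs the change of side streets in `HasLocallyFiniteLines.nest_shift`. -/
theorem IsStationary.map_infinitePi {τ : Measure StreetSystem} [IsProbabilityMeasure τ]
    (hτ : IsStationary τ) (i : ℤ × ℤ) (y : Plane) :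
    MeasurePreserving (fun (t : ℤ × ℤ → StreetSystem) j => (t (j + i)).shift y)
      (Measure.infinitePi fun _ => τ) (Measure.infinitePi fun _ => τ) := by
  have h1 : Measurable fun (t : ℤ × ℤ → StreetSystem) j => (t j).shift y :=
    measurable_pi_lambda _ fun j => (measurable_shift_const y).comp (measurable_pi_apply j)
  have h2 : Measurable fun (t : ℤ × ℤ → StreetSystem) j => t (j + i) :=
    measurable_pi_lambda _ fun j => measurable_pi_apply _
  refine ⟨h1.comp h2, ?_⟩
  have h3 := Measure.map_map (μ := Measure.infinitePi fun _ => τ) h1 h2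
  refine h3.symm.trans ?_
  rw [Measure.map_infinitePi_infinitePi_of_inj (P := fun _ => τ) (add_left_injective i),
    Measure.infinitePi_map_pi (fun _ => τ) (f := fun _ r => r.shift y)
      fun _ => measurable_shift_const y]
  simp only [hτ y]

/-! ### The Palm formula for nested street systems -/

section Main

open Filter

/-- The integral of `f (S - y)` over the points `y` of `S` in the unit square. -/
def palmIntegral (f : StreetSystem → ℝ≥0∞) (S : StreetSystem) : ℝ≥0∞ :=
  ∫⁻ y in (S : Set Plane) ∩ unitSquare, f (S.shift y) ∂Measure.hausdorffMeasure 1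

variable {f : StreetSystem → ℝ≥0∞}

/-- Where the length is finite, the integral is one against the measurable kernel `lengthOn`;
nothing is claimed elsewhere, hence only almost everywhere measurability. -/
theorem aemeasurable_palmIntegral (hf : Measurable f) {ρ : Measure StreetSystem}
    (h : ∀ᵐ S : StreetSystem ∂ρ, Measure.hausdorffMeasure 1 ((S : Set Plane) ∩ unitSquare) < ∞) :
    AEMeasurable (palmIntegral f) ρ := by
  refine ⟨_, measurable_lintegral_lengthOn (g := fun q => f (q.1.shift q.2))
    (hf.comp measurable_shift) isCompact_unitSquare, ?_⟩
  filter_upwards [h] with S hS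
  rw [lengthOn_eq hS]
  rfl

/-- Points of block `i` of `S` in the unit square. -/
def blockInSquare (S : StreetSystem) (i : ℤ × ℤ) : Set Plane :=
  {y ∈ unitSquare | blockIndex S y = i}

theorem HasLocallyFiniteLines.measurableSet_blockInSquare {S : StreetSystem}
    (hS : HasLocallyFiniteLines S) (i : ℤ × ℤ) : MeasurableSet (blockInSquare S i) :=
  isClosed_unitSquare.measurableSet.inter (hS.measurable_blockIndex (measurableSet_singleton i))

theorem iUnion_blockInSquare (S : StreetSystem) : ⋃ i, blockInSquare S i = unitSquare := by
  ext y
  simp [blockInSquare]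

theorem pairwise_disjoint_blockInSquare (S : StreetSystem) :
    Pairwise fun i j => Disjoint (blockInSquare S i) (blockInSquare S j) := by
  intro i j hij
  refine Set.disjoint_left.2 fun y hi hj => hij ?_
  rw [← hi.2, ← hj.2]

theorem HasLocallyFiniteLines.coe_nest_inter_unitSquare {S : StreetSystem}
    (hS : HasLocallyFiniteLines S) (T : ℤ × ℤ → StreetSystem) :
    (nest S T : Set Plane) ∩ unitSquare =
      ((S : Set Plane) ∩ unitSquare) ∪ ⋃ i, ((T i : Set Plane) ∩ blockInSquare S i) := by
  rw [hS.coe_nest, Set.union_inter_distrib_right]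
  congr 1
  ext y
  simp only [Set.mem_inter_iff, Set.mem_ofPred_eq, Set.mem_iUnion, blockInSquare]
  constructor
  · rintro ⟨h, hy⟩
    exact ⟨_, h, hy, rfl⟩
  · rintro ⟨i, h, hy, rfl⟩
    exact ⟨h, hy⟩

/-- Only finitely many blocks meet the unit square. -/
theorem HasLocallyFiniteLines.length_nest_lt_top {S : StreetSystem}
    (hS : HasLocallyFiniteLines S) {T : ℤ × ℤ → StreetSystem}
    (hSQ : Measure.hausdorffMeasure 1 ((S : Set Plane) ∩ unitSquare) < ∞)
    (hTQ : ∀ i, Measure.hausdorffMeasure 1 ((T i : Set Plane) ∩ unitSquare) < ∞) :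
    Measure.hausdorffMeasure 1 ((nest S T : Set Plane) ∩ unitSquare) < ∞ := by
  have h : (nest S T : Set Plane) ∩ unitSquare ⊆ ((S : Set Plane) ∩ unitSquare) ∪
      ⋃ i ∈ hS.finite_blockIndex.toFinset, ((T i : Set Plane) ∩ unitSquare) := by
    rw [hS.coe_nest_inter_unitSquare]
    refine Set.union_subset_union_right _ (Set.iUnion_subset fun i y hy => ?_)
    refine Set.mem_iUnion₂.2 ⟨i, ?_, hy.1, hy.2.1⟩
    exact hS.finite_blockIndex.mem_toFinset.2 ⟨y, hy.2⟩
  refine (measure_mono h).trans_lt ((measure_union_le _ _).trans_lt (ENNReal.add_lt_top.2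
    ⟨hSQ, (measure_biUnion_finset_le _ _).trans_lt (ENNReal.sum_lt_top.2 fun i _ => hTQ i)⟩))

/-- Splitting the length of a nested system into the main streets and the side streets. -/
theorem HasLocallyFiniteLines.palmIntegral_nest {S : StreetSystem}
    (hS : HasLocallyFiniteLines S) {T : ℤ × ℤ → StreetSystem}
    (hST : ∀ i, Measure.hausdorffMeasure 1 ((T i : Set Plane) ∩ ((S : Set Plane) ∩ unitSquare)) = 0)
    (f : StreetSystem → ℝ≥0∞) :
    palmIntegral f (nest S T) =
      ∫⁻ y in (S : Set Plane) ∩ unitSquare, f ((nest S T).shift y) ∂Measure.hausdorffMeasure 1 +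
      ∑' i, ∫⁻ y in (T i : Set Plane), (blockInSquare S i).indicator
        (fun y => f ((nest S T).shift y)) y ∂Measure.hausdorffMeasure 1 := by
  have hm (i : ℤ × ℤ) : MeasurableSet ((T i : Set Plane) ∩ blockInSquare S i) :=
    (T i).isClosed.measurableSet.inter (hS.measurableSet_blockInSquare i)
  rw [palmIntegral, hS.coe_nest_inter_unitSquare, Measure.restrict_union₀, lintegral_add_measure,
    Measure.restrict_iUnion, lintegral_sum_measure]
  · congr 1
    refine tsum_congr fun i => ?_
    rw [lintegral_indicator (hS.measurableSet_blockInSquare i),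
      Measure.restrict_restrict (hS.measurableSet_blockInSquare i), Set.inter_comm]
  · exact fun i j hij => (pairwise_disjoint_blockInSquare S hij).mono Set.inter_subset_right
      Set.inter_subset_right
  · exact hm
  -- Blocks contain points of `S`, so main and side parts can overlap, but only in a null set by
  -- `hST`.
  · refine measure_mono_null (t := ⋃ i, ((T i : Set Plane) ∩ ((S : Set Plane) ∩ unitSquare))) ?_
      (measure_iUnion_null hST)
    rintro y ⟨hy, hy2⟩
    obtain ⟨i, hi⟩ := Set.mem_iUnion.1 hy2
    exact Set.mem_iUnion.2 ⟨i, hi.1, hy⟩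
  · exact (MeasurableSet.iUnion hm).nullMeasurableSet

theorem IsPalmVersion.lintegral_eq_palmIntegral {μ μ' : Measure StreetSystem}
    [IsProbabilityMeasure μ'] (hμ' : IsPalmVersion μ id μ' id)
    (hf : Measurable f) : ∫⁻ S, palmIntegral f S ∂μ = intensity μ id * ∫⁻ S, f S ∂μ' := by
  obtain ⟨h0, ht⟩ := hμ'.intensity_ne
  have h := hμ'.2 f hf
  simp only [id] at h
  rw [h, ← mul_assoc, ENNReal.mul_inv_cancel h0 ht, one_mul]
  rfl

theorem ae_length_lt_top {μ : Measure StreetSystem} (h : intensity μ id ≠ ∞) :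
    ∀ᵐ S : StreetSystem ∂μ, Measure.hausdorffMeasure 1 ((S : Set Plane) ∩ unitSquare) < ∞ :=
  ae_lt_top (measurable_length_inter isCompact_unitSquare) h

/-- The law of the side streets. -/
abbrev sideLaw (τ : Measure StreetSystem) [IsProbabilityMeasure τ] :
    Measure (ℤ × ℤ → StreetSystem) :=
  Measure.infinitePi fun _ => τ

theorem ae_length_nestM_lt_top {μ τ : Measure StreetSystem} [SFinite μ]
    [IsProbabilityMeasure τ] (hlines : ∀ᵐ S ∂μ, HasLocallyFiniteLines S)
    (hμ : intensity μ id ≠ ∞) (hτ : intensity τ id ≠ ∞) :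
    ∀ᵐ q ∂μ.prod (sideLaw τ),
      Measure.hausdorffMeasure 1 ((nestM q : Set Plane) ∩ unitSquare) < ∞ := by
  have hm : MeasurableSet {q : StreetSystem × (ℤ × ℤ → StreetSystem) |
      Measure.hausdorffMeasure 1 ((nestM q : Set Plane) ∩ unitSquare) < ∞} :=
    measurableSet_lt ((measurable_length_inter isCompact_unitSquare).comp measurable_nestM)
      measurable_const
  refine (Measure.ae_prod_mem_iff_ae_ae_mem hm).2 ?_
  have hT : ∀ᵐ t ∂sideLaw τ, ∀ i,
      Measure.hausdorffMeasure 1 ((t i : Set Plane) ∩ unitSquare) < ∞ :=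
    ae_all_iff.2 fun i => (measurePreserving_eval_infinitePi
      (fun _ : ℤ × ℤ => τ) i).quasiMeasurePreserving.ae (ae_length_lt_top hτ)
  filter_upwards [hlines, ae_length_lt_top hμ] with S hS hSQ
  filter_upwards [hT] with t ht
  rw [hS.nestM_eq]
  exact hS.length_nest_lt_top hSQ ht

variable {μ μ' τ τ' : Measure StreetSystem} [IsProbabilityMeasure μ] [IsProbabilityMeasure μ']
  [IsProbabilityMeasure τ] [IsProbabilityMeasure τ']

theorem measurable_nestM_shift (hf : Measurable f) (S : StreetSystem) :
    Measurable fun q : (ℤ × ℤ → StreetSystem) × Plane => f ((nestM (S, q.1)).shift q.2) := by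
  have h : Measurable fun q : (ℤ × ℤ → StreetSystem) × Plane => (S, q.1) :=
    measurable_const.prodMk measurable_fst
  exact hf.comp (measurable_shift.comp ((measurable_nestM.comp h).prodMk measurable_snd))

/-- The relabelling depends on `S` and `y` only, both fixed here, so the side streets seen from `y`
have their original joint law. -/
theorem IsStationary.lintegral_nestM_shift (hτ : IsStationary τ) (hf : Measurable f)
    {S : StreetSystem} (hS : HasLocallyFiniteLines S) (y : Plane) :
    ∫⁻ t, f ((nestM (S, t)).shift y) ∂sideLaw τ =
      ∫⁻ t, f (nestM (S.shift y, t)) ∂sideLaw τ := by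
  rw [← (hτ.map_infinitePi (blockIndex S y) y).lintegral_comp
    (f := fun t => f (nestM (S.shift y, t)))
    (hf.comp (measurable_nestM.comp measurable_prodMk_left))]
  refine lintegral_congr fun t => ?_
  rw [hS.nestM_eq, hS.nest_shift, (hS.shift y).nestM_eq]

/-- The side grid of the block containing `y` is held fixed and arrives in slot `0`; the others are
averaged out as before. -/
theorem IsStationary.lintegral_nestM_update_shift (hτ : IsStationary τ) (hf : Measurable f)
    {S : StreetSystem} (hS : HasLocallyFiniteLines S) (r : StreetSystem) (y : Plane) :
    ∫⁻ t, f ((nestM (S, Function.update t (blockIndex S y) r)).shift y) ∂sideLaw τ =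
      ∫⁻ t, f (nestM (S.shift y, Function.update t 0 (r.shift y))) ∂sideLaw τ := by
  rw [← (hτ.map_infinitePi (blockIndex S y) y).lintegral_comp
    (f := fun t => f (nestM (S.shift y, Function.update t 0 (r.shift y))))
    (hf.comp (measurable_nestM.comp (measurable_prodMk_left.comp measurable_update_left)))]
  refine lintegral_congr fun t => ?_
  rw [hS.nestM_eq, hS.nest_shift, (hS.shift y).nestM_eq]
  congr 2
  funext j
  rcases eq_or_ne j 0 with rfl | hj
  · simp
  · rw [Function.update_of_ne hj, Function.update_of_ne (by simpa using hj)]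

theorem measurable_lintegral_nestM (hf : Measurable f) :
    Measurable fun S => ∫⁻ t, f (nestM (S, t)) ∂sideLaw τ :=
  Measurable.lintegral_prod_right' (f := fun q => f (nestM q)) (hf.comp measurable_nestM)

theorem measurable_lintegral_nestM_update (hf : Measurable f) :
    Measurable fun q : StreetSystem × StreetSystem =>
      ∫⁻ t, f (nestM (q.1, Function.update t 0 q.2)) ∂sideLaw τ := by
  have h : Measurable fun q : (StreetSystem × StreetSystem) × (ℤ × ℤ → StreetSystem) =>
      Function.update q.2 (0 : ℤ × ℤ) q.1.2 :=
    measurable_update'.comp (measurable_snd.prodMk (measurable_snd.comp measurable_fst))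
  exact Measurable.lintegral_prod_right'
    (f := fun q : (StreetSystem × StreetSystem) × (ℤ × ℤ → StreetSystem) =>
      f (nestM (q.1.1, Function.update q.2 0 q.1.2)))
    (hf.comp (measurable_nestM.comp ((measurable_fst.comp measurable_fst).prodMk h)))

/-- The contribution of the side streets in block `i`. -/
theorem IsPalmVersion.lintegral_side_streets (hτ : IsStationary τ)
    (hτ' : IsPalmVersion τ id τ' id) (hf : Measurable f) {S : StreetSystem}
    (hS : HasLocallyFiniteLines S) (i : ℤ × ℤ) :
    ∫⁻ t, ∫⁻ y, (blockInSquare S i).indicator (fun y => f ((nestM (S, t)).shift y)) y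
        ∂lengthKernel (t i) ∂sideLaw τ =
      intensity τ id * ∫⁻ y in blockInSquare S i, ∫⁻ r, ∫⁻ t,
        f (nestM (S.shift y, Function.update t 0 r)) ∂sideLaw τ ∂τ' := by
  have hE := hS.measurableSet_blockInSquare i
  have hH : Measurable fun q : (ℤ × ℤ → StreetSystem) × Plane =>
      (blockInSquare S i).indicator (fun y => f ((nestM (S, q.1)).shift y)) q.2 := by
    exact (measurable_nestM_shift hf S).indicator (measurable_snd hE)
  have hu (r : StreetSystem) : Measurable fun q : (ℤ × ℤ → StreetSystem) × Plane =>
      (Function.update q.1 i r, q.2) :=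
    (measurable_update_left.comp measurable_fst).prodMk measurable_snd
  have hΘ : Measurable fun t : ℤ × ℤ → StreetSystem => ∫⁻ y, (blockInSquare S i).indicator
      (fun y => f ((nestM (S, t)).shift y)) y ∂lengthKernel (t i) :=
    Measurable.lintegral_kernel_prod_right'
      (κ := lengthKernel.comap (fun t : ℤ × ℤ → StreetSystem => t i) (measurable_pi_apply i)) hH
  have hg : Measurable fun q : Plane × StreetSystem => (blockInSquare S i).indicator
      (fun y => ∫⁻ t, f (nestM (S.shift y, Function.update t 0 q.2)) ∂sideLaw τ) q.1 := by
    have h : Measurable fun q : Plane × StreetSystem =>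
        ∫⁻ t, f (nestM (S.shift q.1, Function.update t 0 q.2)) ∂sideLaw τ :=
      (measurable_lintegral_nestM_update hf).comp
        (((measurable_shift_left S).comp measurable_fst).prodMk measurable_snd)
    exact h.indicator (measurable_fst hE)
  -- The grid in block `i` is made an independent variable `r`, so that the Campbell formula can
  -- later be applied to it alone.
  rw [lintegral_infinitePi_update (fun _ => τ) i hΘ]
  have h1 (r : StreetSystem) : ∫⁻ t, ∫⁻ y, (blockInSquare S i).indicator
        (fun y => f ((nestM (S, Function.update t i r)).shift y)) y
          ∂lengthKernel (Function.update t i r i) ∂sideLaw τ =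
      ∫⁻ y, (blockInSquare S i).indicator (fun y => ∫⁻ t,
        f (nestM (S.shift y, Function.update t 0 (r.shift y))) ∂sideLaw τ) y ∂lengthKernel r := by
    simp only [Function.update_self]
    rw [lintegral_lintegral_swap (f := fun t y => (blockInSquare S i).indicator
      (fun y => f ((nestM (S, Function.update t i r)).shift y)) y) (hH.comp (hu r)).aemeasurable]
    refine lintegral_congr fun y => ?_
    by_cases hy : y ∈ blockInSquare S i
    · simp only [Set.indicator_of_mem hy]
      rw [← hτ.lintegral_nestM_update_shift hf hS, hy.2]
    · simp [Set.indicator_of_notMem hy]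
  simp only [h1]
  -- After averaging the other grids, the integrand depends on `y` and `r - y` only, as the Campbell
  -- formula requires.
  have h2 := hτ'.lintegral_eq hτ hg
  have h3 : ∀ᵐ r ∂τ, HasLocallyFiniteLength r :=
    hτ.ae_hasLocallyFiniteLength hτ'.intensity_ne.2
  rw [← lintegral_indicator hE]
  have h4 : (fun y => (blockInSquare S i).indicator (fun y => ∫⁻ r, ∫⁻ t,
        f (nestM (S.shift y, Function.update t 0 r)) ∂sideLaw τ ∂τ') y) =
      fun y => ∫⁻ r, (blockInSquare S i).indicator (fun y => ∫⁻ t,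
        f (nestM (S.shift y, Function.update t 0 r)) ∂sideLaw τ) y ∂τ' := by
    funext y
    by_cases hy : y ∈ blockInSquare S i
    · simp only [Set.indicator_of_mem hy]
    · simp [Set.indicator_of_notMem hy]
  rw [h4, ← h2]
  refine lintegral_congr_ae ?_
  filter_upwards [h3] with r hr
  rw [lengthKernel_apply hr]
  refine lintegral_congr fun y => ?_
  by_cases hy : y ∈ blockInSquare S i
  · simp only [Set.indicator_of_mem hy]
  · simp only [Set.indicator_of_notMem hy]

/-- With the main grid frozen, its streets in the square form a fixed compact set of area zero,
which makes the splitting of lengths exact. The side contributions of the single blocks reassemble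
to the whole square. -/
theorem IsPalmVersion.lintegral_palmIntegral_nest_fixed (hτ : IsStationary τ)
    (hτ' : IsPalmVersion τ id τ' id) (hf : Measurable f) {S : StreetSystem}
    (hS : HasLocallyFiniteLines S)
    (hSQ : Measure.hausdorffMeasure 1 ((S : Set Plane) ∩ unitSquare) < ∞) :
    ∫⁻ t, palmIntegral f (nestM (S, t)) ∂sideLaw τ =
      palmIntegral (fun s => ∫⁻ t, f (nestM (s, t)) ∂sideLaw τ) S +
      intensity τ id * ∫⁻ y in unitSquare, ∫⁻ r, ∫⁻ t,
        f (nestM (S.shift y, Function.update t 0 r)) ∂sideLaw τ ∂τ' := by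
  have hfin : IsFiniteMeasure ((Measure.hausdorffMeasure 1 : Measure Plane).restrict
    ((S : Set Plane) ∩ unitSquare)) := ⟨by simpa using hSQ⟩
  have hF : Measurable fun q : (ℤ × ℤ → StreetSystem) × Plane => f ((nestM (S, q.1)).shift q.2) :=
    measurable_nestM_shift hf S
  have heval {p : StreetSystem → Prop} (hp : ∀ᵐ r ∂τ, p r) (i : ℤ × ℤ) :
      ∀ᵐ t ∂sideLaw τ, p (t i) :=
    (measurePreserving_eval_infinitePi (fun _ : ℤ × ℤ => τ) i).quasiMeasurePreserving.ae hp
  have hlf : ∀ᵐ t ∂sideLaw τ, ∀ i, HasLocallyFiniteLength (t i) :=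
    ae_all_iff.2 (heval (hτ.ae_hasLocallyFiniteLength hτ'.intensity_ne.2))
  have hnull : ∀ᵐ t ∂sideLaw τ, ∀ i, Measure.hausdorffMeasure 1
      ((t i : Set Plane) ∩ ((S : Set Plane) ∩ unitSquare)) = 0 :=
    ae_all_iff.2 (heval (hτ'.ae_length_inter_eq_zero hτ
      (isCompact_unitSquare.inter_left S.isClosed) (volume_eq_zero_of_length_lt_top hSQ)))
  have hsplit : ∀ᵐ t ∂sideLaw τ, palmIntegral f (nestM (S, t)) =
      ∫⁻ y in (S : Set Plane) ∩ unitSquare, f ((nestM (S, t)).shift y)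
        ∂Measure.hausdorffMeasure 1 +
      ∑' i, ∫⁻ y, (blockInSquare S i).indicator (fun y => f ((nestM (S, t)).shift y)) y
        ∂lengthKernel (t i) := by
    filter_upwards [hlf, hnull] with t ht1 ht2
    rw [hS.nestM_eq, hS.palmIntegral_nest ht2]
    simp only [lengthKernel_apply (ht1 _)]
  rw [lintegral_congr_ae hsplit, lintegral_add_left hF.lintegral_prod_right', lintegral_tsum]
  · congr 1
    · rw [lintegral_lintegral_swap hF.aemeasurable]
      exact lintegral_congr fun y => hτ.lintegral_nestM_shift hf hS y
    · simp only [hτ'.lintegral_side_streets hτ hf hS]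
      rw [ENNReal.tsum_mul_left, ← lintegral_iUnion hS.measurableSet_blockInSquare
        (pairwise_disjoint_blockInSquare S), iUnion_blockInSquare]
  · intro i
    refine Measurable.aemeasurable ?_
    exact Measurable.lintegral_kernel_prod_right'
      (κ := lengthKernel.comap (fun t : ℤ × ℤ → StreetSystem => t i) (measurable_pi_apply i))
      (hF.indicator (measurable_snd (hS.measurableSet_blockInSquare i)))

/-- The Palm formula for a nested street system. -/
theorem IsPalmVersion.lintegral_palmIntegral_nest (hμ : IsStationary μ) (hτ : IsStationary τ)
    (hlines : ∀ᵐ S ∂μ, HasLocallyFiniteLines S) (hμ' : IsPalmVersion μ id μ' id)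
    (hτ' : IsPalmVersion τ id τ' id) (hf : Measurable f) :
    ∫⁻ q, palmIntegral f (nestM q) ∂μ.prod (sideLaw τ) =
      intensity μ id * ∫⁻ q, f (nestM q) ∂μ'.prod (sideLaw τ) +
      intensity τ id * ∫⁻ q, f (nestM (q.1, Function.update q.2.2 0 q.2.1))
        ∂μ.prod (τ'.prod (sideLaw τ)) := by
  have hμt := hμ'.intensity_ne.2
  have hfin := ae_length_nestM_lt_top (τ := τ) hlines hμt hτ'.intensity_ne.2
  have hpm : AEMeasurable (fun q => palmIntegral f (nestM q)) (μ.prod (sideLaw τ)) := by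
    refine (aemeasurable_palmIntegral hf ?_).comp_measurable measurable_nestM
    exact (ae_map_iff measurable_nestM.aemeasurable (measurableSet_lt
      (measurable_length_inter isCompact_unitSquare) measurable_const)).2 hfin
  let Γ : StreetSystem → ℝ≥0∞ := fun S =>
    ∫⁻ r, ∫⁻ t, f (nestM (S, Function.update t 0 r)) ∂sideLaw τ ∂τ'
  have hΓ : Measurable Γ := (measurable_lintegral_nestM_update hf).lintegral_prod_right'
  have hF := measurable_lintegral_nestM (τ := τ) hf
  have hΓs : Measurable fun q : StreetSystem × Plane => Γ (q.1.shift q.2) :=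
    hΓ.comp measurable_shift
  have h1 : ∀ᵐ S ∂μ, ∫⁻ t, palmIntegral f (nestM (S, t)) ∂sideLaw τ =
      palmIntegral (fun s => ∫⁻ t, f (nestM (s, t)) ∂sideLaw τ) S +
        intensity τ id * ∫⁻ y in unitSquare, Γ (S.shift y) := by
    filter_upwards [hlines, ae_length_lt_top hμt] with S hS hSQ
    exact hτ'.lintegral_palmIntegral_nest_fixed hτ hf hS hSQ
  -- Stationarity of the main grid removes the shift, and the square has area one.
  have h2 : ∫⁻ S, (∫⁻ y in unitSquare, Γ (S.shift y)) ∂μ = ∫⁻ S, Γ S ∂μ := by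
    rw [lintegral_lintegral_swap hΓs.aemeasurable]
    simp only [fun y : Plane => (hμ.measurePreserving y).lintegral_comp hΓ]
    simp [volume_unitSquare]
  have hupd : Measurable fun q : StreetSystem × StreetSystem × (ℤ × ℤ → StreetSystem) =>
      f (nestM (q.1, Function.update q.2.2 0 q.2.1)) := by
    have h : Measurable fun q : StreetSystem × StreetSystem × (ℤ × ℤ → StreetSystem) =>
        Function.update q.2.2 (0 : ℤ × ℤ) q.2.1 :=
      measurable_update'.comp ((measurable_snd.comp measurable_snd).prodMk
        (measurable_fst.comp measurable_snd))
    exact hf.comp (measurable_nestM.comp (measurable_fst.prodMk h))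
  have h3 : ∫⁻ q, f (nestM (q.1, Function.update q.2.2 0 q.2.1)) ∂μ.prod (τ'.prod (sideLaw τ)) =
      ∫⁻ S, Γ S ∂μ := by
    rw [lintegral_prod _ hupd.aemeasurable]
    refine lintegral_congr fun S => ?_
    exact lintegral_prod _ (hupd.comp measurable_prodMk_left).aemeasurable
  rw [lintegral_prod _ hpm, lintegral_congr_ae h1,
    lintegral_add_left' (aemeasurable_palmIntegral hF (ae_length_lt_top hμt)),
    lintegral_const_mul _ hΓs.lintegral_prod_right', h2, h3, hμ'.lintegral_eq_palmIntegral hF,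
    lintegral_prod (fun q => f (nestM q)) (hf.comp measurable_nestM).aemeasurable]

end Main

/-! ### Two-sided partial sums -/

section GapSum

open Filter Topology

/-- The points of the two-sided sequence with gaps `I` whose zeroth point is `0`. -/
def gapSum (I : ℤ → ℝ) : ℤ → ℝ
  | Int.ofNat k => ∑ j ∈ Finset.range k, I j
  | Int.negSucc k => -∑ j ∈ Finset.range (k + 1), I (-(j + 1))

variable (I : ℤ → ℝ)

theorem gapSum_natCast (k : ℕ) : gapSum I k = ∑ j ∈ Finset.range k, I j := rfl

theorem gapSum_zero : gapSum I 0 = 0 := by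
  have := gapSum_natCast I 0
  simpa using this

theorem gapSum_neg_natCast (k : ℕ) :
    gapSum I (-(k : ℤ)) = -∑ j ∈ Finset.range k, I (-(j + 1)) := by
  cases k with
  | zero => simp [gapSum_zero]
  | succ k => rfl

theorem gapSum_add_one (k : ℤ) : gapSum I (k + 1) = gapSum I k + I k := by
  obtain ⟨n, rfl | rfl⟩ := k.eq_nat_or_neg
  · have := gapSum_natCast I (n + 1)
    rw [Finset.sum_range_succ, ← gapSum_natCast] at this
    exact_mod_cast this
  · cases n with
    | zero =>
      have := gapSum_natCast I 1
      simpa [gapSum_zero] using this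
    | succ n =>
      have h : -((n + 1 : ℕ) : ℤ) + 1 = -(n : ℤ) := by push_cast; ring
      rw [h, gapSum_neg_natCast, gapSum_neg_natCast, Finset.sum_range_succ]
      push_cast
      ring

/-- The cocycle identity behind restarting the sequence at its `k`-th point. -/
theorem gapSum_add (k l : ℤ) : gapSum I (k + l) = gapSum I k + gapSum (fun j => I (j + k)) l := by
  induction l using Int.induction_on with
  | zero => simp [gapSum_zero]
  | succ n ih =>
    rw [← add_assoc, gapSum_add_one, ih, gapSum_add_one, add_comm k, add_assoc]
  | pred n ih =>
    have h1 := gapSum_add_one I (k + (-(n : ℤ) - 1))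
    have h2 := gapSum_add_one (fun j => I (j + k)) (-(n : ℤ) - 1)
    rw [show k + (-(n : ℤ) - 1) + 1 = k + -(n : ℤ) by ring, ih] at h1
    rw [sub_add_cancel] at h2
    rw [h2, add_comm k] at h1
    rw [add_comm k]
    linarith

theorem measurable_gapSum (k : ℤ) : Measurable fun I : ℤ → ℝ => gapSum I k := by
  obtain ⟨n, rfl | rfl⟩ := k.eq_nat_or_neg
  · simp only [gapSum_natCast]
    fun_prop
  · simp only [gapSum_neg_natCast]
    fun_prop

/-- Positive gaps with divergent sums in both directions. -/
structure IsRegularGap (I : ℤ → ℝ) : Prop where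
  pos : ∀ j, 0 < I j
  exists_ge : ∀ b, ∃ k, b ≤ gapSum I k
  exists_le : ∀ b, ∃ k, gapSum I k ≤ b

variable {I}

theorem IsRegularGap.strictMono (hI : IsRegularGap I) : StrictMono (gapSum I) :=
  strictMono_int_of_lt_succ fun k => by
    rw [gapSum_add_one]
    linarith [hI.pos k]

theorem IsRegularGap.existsUnique (hI : IsRegularGap I) (s : ℝ) :
    ∃! k, gapSum I k ≤ s ∧ s < gapSum I (k + 1) := by
  obtain ⟨b, hb⟩ := hI.exists_ge (s + 1)
  obtain ⟨k, hk, hmax⟩ := Int.exists_greatest_of_bdd (P := fun k => gapSum I k ≤ s)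
    ⟨b, fun z hz => (hI.strictMono.lt_iff_lt.1 (by linarith)).le⟩ (hI.exists_le s)
  refine ⟨k, ⟨hk, lt_of_not_ge fun h => ?_⟩, fun l ⟨hl, hl'⟩ => ?_⟩
  · have := hmax _ h
    omega
  · have h1 := hmax _ hl
    have h2 := hI.strictMono.lt_iff_lt.1 (hk.trans_lt hl')
    omega

theorem IsRegularGap.locallyFinite (hI : IsRegularGap I) :
    LocallyFinite (Set.range (gapSum I)) := by
  intro a b
  obtain ⟨k, hk⟩ := hI.exists_le a
  obtain ⟨l, hl⟩ := hI.exists_ge b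
  refine ((Set.finite_Icc k l).image (gapSum I)).subset ?_
  rintro _ ⟨⟨m, rfl⟩, h1, h2⟩
  exact ⟨m, ⟨(hI.strictMono.lt_iff_lt.1 (hk.trans_lt h1)).le,
    hI.strictMono.le_iff_le.1 (h2.trans hl)⟩, rfl⟩

theorem LocallyFinite.isClosed {A : Set ℝ} (hA : LocallyFinite A) : IsClosed A := by
  refine isOpen_compl_iff.1 (isOpen_iff_mem_nhds.2 fun x hx => ?_)
  filter_upwards [(hA (x - 1) (x + 1)).isClosed.isOpen_compl.mem_nhds fun h => hx h.1,
    Ioo_mem_nhds (show x - 1 < x by linarith) (show x < x + 1 by linarith)] with y hy hy2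
  exact fun h => hy ⟨h, Set.Ioo_subset_Ioc_self hy2⟩

end GapSum

/-! ### The stationary renewal process -/

section Renewal

open Filter Topology

variable {ν : Measure ℝ} [IsProbabilityMeasure ν]

/-- The law of an iid two-sided sequence of gaps. -/
abbrev gapLaw (ν : Measure ℝ) [IsProbabilityMeasure ν] : Measure (ℤ → ℝ) :=
  Measure.infinitePi fun _ => ν

theorem IsInterArrivalLaw.integral_pos (hν : IsInterArrivalLaw ν) : 0 < ∫ x, x ∂ν := by
  rw [integral_pos_iff_support_of_nonneg_ae (hν.pos.mono fun x hx => hx.le) hν.integrable]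
  have h : ν (Function.support fun x : ℝ => x) = 1 := by
    refine (prob_compl_eq_zero_iff (measurableSet_support measurable_id')).1 ?_
    refine measure_mono_null ?_ (ae_iff.1 hν.pos)
    intro x hx
    simp only [Set.mem_compl_iff, Function.mem_support, not_not] at hx
    simp [hx]
  rw [h]
  exact one_pos

/-- The strong law of large numbers with positive mean. The enumeration `e` lets it serve both
directions. -/
theorem IsInterArrivalLaw.ae_tendsto (hν : IsInterArrivalLaw ν) {e : ℕ → ℤ}
    (he : Function.Injective e) :
    ∀ᵐ I ∂gapLaw ν, Tendsto (fun n => ∑ j ∈ Finset.range n, I (e j)) atTop atTop := by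
  have hev (i : ℤ) : MeasurePreserving (fun I : ℤ → ℝ => I i) (gapLaw ν) ν :=
    measurePreserving_eval_infinitePi (fun _ => ν) i
  have hind : iIndepFun (fun (i : ℤ) (I : ℤ → ℝ) => I i) (gapLaw ν) :=
    iIndepFun_infinitePi (P := fun _ : ℤ => ν) (X := fun _ x => x) fun _ => measurable_id
  have hlaw := strong_law_ae_real (μ := gapLaw ν) (fun n I => I (e n))
    ((hev _).integrable_comp_of_integrable hν.integrable)
    (fun i j hij => hind.indepFun (he.ne hij)) fun i =>
      ⟨(hev _).aemeasurable, (hev _).aemeasurable, by rw [(hev _).map_eq, (hev _).map_eq]⟩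
  have hmean : ∫ I, I (e 0) ∂gapLaw ν = ∫ x, x ∂ν := by
    have := integral_map (μ := gapLaw ν) (hev (e 0)).aemeasurable
      (f := fun x : ℝ => x) measurable_id.aestronglyMeasurable
    rw [← this, (hev _).map_eq]
  filter_upwards [hlaw] with I hI
  rw [hmean] at hI
  have h := hI.pos_mul_atTop hν.integral_pos tendsto_natCast_atTop_atTop
  refine h.congr' ?_
  filter_upwards [eventually_ne_atTop 0] with n hn
  field_simp

theorem IsInterArrivalLaw.ae_isRegularGap (hν : IsInterArrivalLaw ν) :
    ∀ᵐ I ∂gapLaw ν, IsRegularGap I := by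
  have hpos : ∀ᵐ I ∂gapLaw ν, ∀ j, 0 < I j := ae_all_iff.2 fun j =>
    (measurePreserving_eval_infinitePi (fun _ : ℤ => ν) j).quasiMeasurePreserving.ae hν.pos
  filter_upwards [hpos, hν.ae_tendsto Nat.cast_injective,
    hν.ae_tendsto (e := fun n => -((n : ℤ) + 1)) fun a b h => by simpa using h] with I h1 h2 h3
  refine ⟨h1, fun b => ?_, fun b => ?_⟩
  · obtain ⟨n, hn⟩ := (h2.eventually_ge_atTop b).exists
    exact ⟨n, hn⟩
  · obtain ⟨n, hn⟩ := (h3.eventually_ge_atTop (-b)).exists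
    exact ⟨-(n : ℤ), by rw [gapSum_neg_natCast]; linarith⟩

/-! ### Mass transport and stationarity of the renewal process -/

/-- Passing to the `k`-th point as the origin. -/
def gapShift (k : ℤ) (x : (ℤ → ℝ) × ℝ) : (ℤ → ℝ) × ℝ := (fun j => x.1 (j + k), x.2 - gapSum x.1 k)

/-- A skew product: relabelling preserves the iid law of the gaps, and given the gaps the position
is translated by a constant. -/
theorem measurePreserving_gapShift (k : ℤ) :
    MeasurePreserving (gapShift k) ((gapLaw ν).prod volume) ((gapLaw ν).prod volume) := by
  have h : MeasurePreserving (fun (I : ℤ → ℝ) j => I (j + k)) (gapLaw ν) (gapLaw ν) :=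
    ⟨by fun_prop, Measure.map_infinitePi_infinitePi_of_inj (P := fun _ => ν)
      (add_left_injective k)⟩
  refine h.skew_product (g := fun I s => s - gapSum I k) ?_ (.of_forall fun I => ?_)
  · exact measurable_snd.sub ((measurable_gapSum k).comp measurable_fst)
  · exact (measurePreserving_sub_right volume (gapSum I k)).map_eq

theorem gapShift_neg_gapShift (k : ℤ) (x : (ℤ → ℝ) × ℝ) : gapShift (-k) (gapShift k x) = x := by
  have h := gapSum_add x.1 k (-k)
  rw [add_neg_cancel, gapSum_zero] at h
  refine Prod.ext ?_ ?_
  · simp [gapShift]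
  · simp only [gapShift]
    linarith

/-- Mass transport: two sets that meet almost every orbit exactly once carry the same mass of an
invariant function. -/
theorem lintegral_mul_eq_of_gapShift_invariant {a b G : (ℤ → ℝ) × ℝ → ℝ≥0∞} (ha : Measurable a)
    (hb : Measurable b) (hG : Measurable G) (hinv : ∀ k x, G (gapShift k x) = G x)
    (ha1 : ∀ᵐ x ∂(gapLaw ν).prod volume, ∑' k, a (gapShift k x) = 1)
    (hb1 : ∀ᵐ x ∂(gapLaw ν).prod volume, ∑' k, b (gapShift k x) = 1) :
    ∫⁻ x, a x * G x ∂(gapLaw ν).prod volume = ∫⁻ x, b x * G x ∂(gapLaw ν).prod volume := by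
  have hm (k : ℤ) : Measurable (gapShift k) := (measurePreserving_gapShift (ν := ν) k).measurable
  -- Insert the orbit sum of `b`, move each shift from `b` to `a` by invariance of the measure, and
  -- sum out `a`.
  calc ∫⁻ x, a x * G x ∂(gapLaw ν).prod volume
      = ∫⁻ x, ∑' k, b (gapShift k x) * (a x * G x) ∂(gapLaw ν).prod volume := by
        refine lintegral_congr_ae ?_
        filter_upwards [hb1] with x hx
        rw [ENNReal.tsum_mul_right, hx, one_mul]
    _ = ∑' k, ∫⁻ x, b (gapShift k x) * (a x * G x) ∂(gapLaw ν).prod volume :=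
        lintegral_tsum fun k => ((hb.comp (hm k)).mul (ha.mul hG)).aemeasurable
    _ = ∑' k, ∫⁻ x, b x * (a (gapShift (-k) x) * G x) ∂(gapLaw ν).prod volume := by
        refine tsum_congr fun k => ?_
        have h := (measurePreserving_gapShift (ν := ν) k).lintegral_comp
          (f := fun x => b x * (a (gapShift (-k) x) * G x)) (hb.mul ((ha.comp (hm (-k))).mul hG))
        rw [← h]
        simp only [gapShift_neg_gapShift, hinv]
    _ = ∑' k, ∫⁻ x, b x * (a (gapShift k x) * G x) ∂(gapLaw ν).prod volume :=
        (Equiv.neg ℤ).tsum_eq fun k => ∫⁻ x, b x * (a (gapShift k x) * G x)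
          ∂(gapLaw ν).prod volume
    _ = ∫⁻ x, ∑' k, b x * (a (gapShift k x) * G x) ∂(gapLaw ν).prod volume :=
        (lintegral_tsum fun k => (hb.mul ((ha.comp (hm k)).mul hG)).aemeasurable).symm
    _ = _ := by
        refine lintegral_congr_ae ?_
        filter_upwards [ha1] with x hx
        rw [ENNReal.tsum_mul_left, ENNReal.tsum_mul_right, hx, one_mul]

/-- Positions in the interval of length `I 0` starting at `t`. -/
def gapInterval (t : ℝ) : Set ((ℤ → ℝ) × ℝ) := {x | t ≤ x.2 ∧ x.2 < t + x.1 0}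

theorem measurableSet_gapInterval (t : ℝ) : MeasurableSet (gapInterval t) := by
  have h1 : MeasurableSet {x : (ℤ → ℝ) × ℝ | t ≤ x.2} :=
    measurableSet_le (by fun_prop) (by fun_prop)
  have h2 : MeasurableSet {x : (ℤ → ℝ) × ℝ | x.2 < t + x.1 0} :=
    measurableSet_lt (by fun_prop) (by fun_prop)
  exact h1.inter h2

/-- The half-open gaps tile the line, so `x.2 - t` lies in exactly one of them. -/
theorem IsInterArrivalLaw.ae_tsum_gapInterval (hν : IsInterArrivalLaw ν) (t : ℝ) :
    ∀ᵐ x ∂(gapLaw ν).prod volume,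
      ∑' k, (gapInterval t).indicator (1 : (ℤ → ℝ) × ℝ → ℝ≥0∞) (gapShift k x) = 1 := by
  have h : ∀ᵐ x ∂(gapLaw ν).prod (volume : Measure ℝ), IsRegularGap x.1 :=
    Measure.quasiMeasurePreserving_fst.ae hν.ae_isRegularGap
  filter_upwards [h] with x hx
  have hiff (k : ℤ) : gapShift k x ∈ gapInterval t ↔
      gapSum x.1 k ≤ x.2 - t ∧ x.2 - t < gapSum x.1 (k + 1) := by
    rw [gapSum_add_one]
    simp only [gapInterval, gapShift, Set.mem_ofPred_eq, zero_add]
    constructor <;> rintro ⟨h1, h2⟩ <;> constructor <;> linarith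
  obtain ⟨k, hk, huniq⟩ := hx.existsUnique (x.2 - t)
  rw [tsum_eq_single k fun l hl => Set.indicator_of_notMem
    (fun hmem => hl (huniq l ((hiff l).1 hmem))) _, Set.indicator_of_mem ((hiff k).2 hk)]
  rfl

/-- The closed set of the points of the two-sided sequence with gaps `I`. -/
def gapSet (I : ℤ → ℝ) : Closeds ℝ := Closeds.closure (Set.range (gapSum I))

theorem measurable_gapSet : Measurable gapSet := measurable_closeds_closure_range measurable_gapSum

theorem translate_closure (A : Set ℝ) (y : ℝ) :
    translate (Closeds.closure A) y = Closeds.closure {p | p + y ∈ A} :=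
  Closeds.ext ((Homeomorph.addRight y).preimage_closure A)

theorem translate_translate (F : Closeds ℝ) (y z : ℝ) :
    translate (translate F y) z = translate F (z + y) := by
  ext p
  change p + z + y ∈ F ↔ p + (z + y) ∈ F
  rw [add_assoc]

/-- The configuration seen from a position does not depend on which point is labelled zero; this is
the invariance needed for mass transport. -/
theorem translate_gapSet_gapShift (k : ℤ) (x : (ℤ → ℝ) × ℝ) :
    translate (gapSet (gapShift k x).1) (gapShift k x).2 = translate (gapSet x.1) x.2 := by
  rw [gapSet, gapSet, translate_closure, translate_closure]
  congr 1
  ext p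
  simp only [Set.mem_ofPred_eq, Set.mem_range, gapShift]
  constructor
  · rintro ⟨l, hl⟩
    exact ⟨k + l, by rw [gapSum_add, hl]; ring⟩
  · rintro ⟨l, hl⟩
    refine ⟨-k + l, ?_⟩
    have := gapSum_add x.1 k (-k + l)
    rw [add_neg_cancel_left, hl] at this
    linarith

/-- The gap around the origin takes the unused slot `0`. Its left end is at `(u - 1) * L`, so the
origin lies `(1 - u) * L` to the right of the point labelled zero. -/
theorem closure_arrivals_eq (I : ℤ → ℝ) (L u : ℝ) :
    Closeds.closure (arrivals I L u) =
      translate (gapSet (Function.update I 0 L)) ((1 - u) * L) := by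
  rw [gapSet, translate_closure]
  congr 1
  have hpos (k : ℕ) : gapSum (Function.update I 0 L) ((k + 1 : ℕ) : ℤ) =
      L + ∑ j ∈ Finset.range k, I (j + 1) := by
    rw [gapSum_natCast, Finset.sum_range_succ', add_comm]
    congr 1
  have hneg (k : ℕ) : gapSum (Function.update I 0 L) (-(k : ℤ)) =
      -∑ j ∈ Finset.range k, I (-(j + 1)) := by
    rw [gapSum_neg_natCast]
    congr 1
  ext p
  simp only [arrivals, Set.mem_union, Set.mem_range, Set.mem_ofPred_eq]
  constructor
  · rintro (⟨k, rfl⟩ | ⟨k, rfl⟩)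
    · exact ⟨((k + 1 : ℕ) : ℤ), by rw [hpos]; ring⟩
    · exact ⟨-(k : ℤ), by rw [hneg]; ring⟩
  · rintro ⟨k, hk⟩
    obtain ⟨n, rfl | rfl⟩ := k.eq_nat_or_neg
    · cases n with
      | zero =>
        right
        refine ⟨0, ?_⟩
        rw [Nat.cast_zero, gapSum_zero] at hk
        simp only [Finset.range_zero, Finset.sum_empty]
        linarith
      | succ n =>
        left
        refine ⟨n, ?_⟩
        rw [hpos] at hk
        linarith
    · right
      refine ⟨n, ?_⟩
      rw [hneg] at hk
      linarith

theorem measurable_translate_gapSet :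
    Measurable fun x : (ℤ → ℝ) × ℝ => translate (gapSet x.1) x.2 :=
  measurable_translate.comp ((measurable_gapSet.comp measurable_fst).prodMk measurable_snd)

theorem measurable_translate_gapSet_comp {Ω : Type*} [MeasurableSpace Ω] {I : Ω → ℤ → ℝ}
    {s : Ω → ℝ} (hI : Measurable I) (hs : Measurable s) :
    Measurable fun ω => translate (gapSet (I ω)) (s ω) := by
  have h := (measurable_gapSet.comp hI).prodMk hs
  exact measurable_translate.comp h

theorem measurable_update_zero :
    Measurable fun q : (ℤ → ℝ) × ℝ => Function.update q.1 0 q.2 :=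
  measurable_update' (a := (0 : ℤ)) (X := fun _ => ℝ)

theorem measurable_closure_arrivals :
    Measurable fun q : (ℤ → ℝ) × ℝ × ℝ => Closeds.closure (arrivals q.1 q.2.1 q.2.2) := by
  simp only [closure_arrivals_eq]
  have h0 : Measurable fun q : (ℤ → ℝ) × ℝ × ℝ => (q.1, q.2.1) := by fun_prop
  have h : Measurable fun q : (ℤ → ℝ) × ℝ × ℝ => Function.update q.1 0 q.2.1 :=
    measurable_update_zero.comp h0
  have h1 : Measurable fun q : (ℤ → ℝ) × ℝ × ℝ => (1 - q.2.2) * q.2.1 := by fun_prop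
  exact measurable_translate_gapSet_comp h h1

/-- Substitute `s = (1 - u) * L`: the length-bias factor is exactly the Jacobian, and the right
endpoint is negligible. -/
theorem ofReal_mul_lintegral_unif {L : ℝ} (hL : 0 < L) {k : ℝ → ℝ≥0∞} (hk : Measurable k) :
    ENNReal.ofReal L * ∫⁻ u, k ((1 - u) * L) ∂unif = ∫⁻ s in Set.Ico 0 L, k s := by
  have h1 : ∫⁻ u, k ((1 - u) * L) ∂unif = ∫⁻ u, (Set.Icc 0 L).indicator k ((1 - u) * L) := by
    rw [unif, ← lintegral_indicator measurableSet_Icc]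
    refine lintegral_congr fun u => ?_
    have : u ∈ Set.Icc (0 : ℝ) 1 ↔ (1 - u) * L ∈ Set.Icc 0 L := by
      constructor
      · rintro ⟨h1, h2⟩
        exact ⟨mul_nonneg (by linarith) hL.le, mul_le_of_le_one_left hL.le (by linarith)⟩
      · rintro ⟨h1, h2⟩
        have h3 := nonneg_of_mul_nonneg_left h1 hL
        have h4 : (1 - u) ≤ 1 := le_of_mul_le_mul_right (by linarith) hL
        exact ⟨by linarith, by linarith⟩
    by_cases hu : u ∈ Set.Icc (0 : ℝ) 1
    · rw [Set.indicator_of_mem hu, Set.indicator_of_mem (this.1 hu)]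
    · rw [Set.indicator_of_notMem hu, Set.indicator_of_notMem fun h => hu (this.2 h)]
  have hk' : Measurable ((Set.Icc 0 L).indicator k) := hk.indicator measurableSet_Icc
  rw [h1, lintegral_sub_left_eq_self (fun u => (Set.Icc 0 L).indicator k (u * L)),
    ← lintegral_map hk' (measurable_mul_const L), Real.map_volume_mul_right hL.ne',
    lintegral_smul_measure, lintegral_indicator measurableSet_Icc,
    ← Measure.restrict_congr_set Ico_ae_eq_Icc, smul_eq_mul, ← mul_assoc,
    abs_of_pos (by positivity),
    ← ENNReal.ofReal_mul hL.le, mul_inv_cancel₀ hL.ne', ENNReal.ofReal_one, one_mul]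

instance : SFinite (lengthBiased ν) := by
  unfold lengthBiased
  infer_instance

instance : SFinite unif := by
  unfold unif
  infer_instance

/-- The stationary renewal process is the process started from a point, seen from a uniform
position in the first gap. -/
theorem IsInterArrivalLaw.lintegral_stationaryRenewalLaw (hν : IsInterArrivalLaw ν)
    {F : Closeds ℝ → ℝ≥0∞} (hF : Measurable F) :
    ∫⁻ A, F A ∂stationaryRenewalLaw ν = (∫⁻ x, ENNReal.ofReal x ∂ν)⁻¹ *
      ∫⁻ x, (gapInterval 0).indicator 1 x * F (translate (gapSet x.1) x.2)
        ∂(gapLaw ν).prod volume := by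
  have hG : Measurable fun x : (ℤ → ℝ) × ℝ => F (translate (gapSet x.1) x.2) :=
    hF.comp measurable_translate_gapSet
  have hupd := measurable_update_zero
  let Ψ : (ℤ → ℝ) → ℝ≥0∞ := fun I =>
    ∫⁻ s, (gapInterval 0).indicator 1 (I, s) * F (translate (gapSet I) s)
  have hint : Measurable fun x : (ℤ → ℝ) × ℝ =>
      (gapInterval 0).indicator (1 : (ℤ → ℝ) × ℝ → ℝ≥0∞) x * F (translate (gapSet x.1) x.2) :=
    (measurable_one.indicator (measurableSet_gapInterval 0)).mul hG
  have hΨ : Measurable Ψ := hint.lintegral_prod_right'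
  let ψ : (ℤ → ℝ) × ℝ → ℝ≥0∞ := fun q =>
    ∫⁻ u, F (translate (gapSet (Function.update q.1 0 q.2)) ((1 - u) * q.2)) ∂unif
  have hψ : Measurable ψ := by
    refine Measurable.lintegral_prod_right' (f := fun q : ((ℤ → ℝ) × ℝ) × ℝ =>
      F (translate (gapSet (Function.update q.1.1 0 q.1.2)) ((1 - q.2) * q.1.2))) ?_
    have h1 : Measurable fun q : ((ℤ → ℝ) × ℝ) × ℝ => Function.update q.1.1 0 q.1.2 :=
      hupd.comp measurable_fst
    have h2 : Measurable fun q : ((ℤ → ℝ) × ℝ) × ℝ => (1 - q.2) * q.1.2 := by fun_prop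
    exact hF.comp (measurable_translate_gapSet_comp h1 h2)
  have hΨψ (I : ℤ → ℝ) {L : ℝ} (hL : 0 < L) :
      ENNReal.ofReal L * ψ (I, L) = Ψ (Function.update I 0 L) := by
    simp only [ψ, Ψ]
    rw [ofReal_mul_lintegral_unif hL
      (k := fun s => F (translate (gapSet (Function.update I 0 L)) s))
      (hF.comp (measurable_translate_gapSet_comp measurable_const measurable_id)),
      ← lintegral_indicator measurableSet_Ico]
    refine lintegral_congr fun s => ?_
    by_cases hs : s ∈ Set.Ico 0 L
    · rw [Set.indicator_of_mem hs, Set.indicator_of_mem]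
      · simp
      · simpa [gapInterval] using hs
    · rw [Set.indicator_of_notMem hs, Set.indicator_of_notMem, zero_mul]
      simpa [gapInterval] using hs
  have h1 : ∫⁻ A, F A ∂stationaryRenewalLaw ν =
      ∫⁻ I, ∫⁻ L, ψ (I, L) ∂lengthBiased ν ∂gapLaw ν := by
    rw [stationaryRenewalLaw, lintegral_map hF measurable_closure_arrivals,
      lintegral_prod (fun q : (ℤ → ℝ) × ℝ × ℝ => F (Closeds.closure (arrivals q.1 q.2.1 q.2.2)))
        (hF.comp measurable_closure_arrivals).aemeasurable]
    refine lintegral_congr fun I => ?_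
    have hI : Measurable fun q : ℝ × ℝ => (I, q) := measurable_prodMk_left
    have := lintegral_prod (μ := lengthBiased ν) (ν := unif)
      (fun q : ℝ × ℝ => F (Closeds.closure (arrivals I q.1 q.2)))
      (hF.comp (measurable_closure_arrivals.comp hI)).aemeasurable
    rw [this]
    simp only [closure_arrivals_eq, ψ]
  have h2 (I : ℤ → ℝ) : ∫⁻ L, ψ (I, L) ∂lengthBiased ν =
      (∫⁻ x, ENNReal.ofReal x ∂ν)⁻¹ * ∫⁻ L, Ψ (Function.update I 0 L) ∂ν := by
    rw [lengthBiased, lintegral_smul_measure, smul_eq_mul,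
      lintegral_withDensity_eq_lintegral_mul _ ENNReal.measurable_ofReal
        (g := fun L => ψ (I, L)) (hψ.comp measurable_prodMk_left)]
    congr 1
    refine lintegral_congr_ae ?_
    filter_upwards [hν.pos] with L hL
    exact hΨψ I hL
  have h3 : Measurable fun q : (ℤ → ℝ) × ℝ => Ψ (Function.update q.1 0 q.2) := hΨ.comp hupd
  rw [h1]
  simp only [h2]
  -- With the bias absorbed, slot `0` holds a fresh gap of law `ν`, so the update is a mere
  -- resampling and disappears.
  rw [lintegral_const_mul _ h3.lintegral_prod_right',
    lintegral_lintegral_swap h3.aemeasurable, ← lintegral_infinitePi_update (fun _ => ν) 0 hΨ,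
    lintegral_prod _ hint.aemeasurable]

/-- Translation by `t` replaces the representatives `gapInterval 0` by `gapInterval t`; both meet
almost every orbit once, so mass transport equates the integrals. -/
theorem IsInterArrivalLaw.measurePreserving_translate (hν : IsInterArrivalLaw ν) (t : ℝ) :
    MeasurePreserving (fun A : Closeds ℝ => translate A t) (stationaryRenewalLaw ν)
      (stationaryRenewalLaw ν) := by
  have hm : Measurable fun A : Closeds ℝ => translate A t :=
    measurable_translate.comp (measurable_id.prodMk measurable_const)
  refine ⟨hm, Measure.ext_of_lintegral _ fun F hF => ?_⟩
  have hG : Measurable fun x : (ℤ → ℝ) × ℝ => F (translate (gapSet x.1) x.2) :=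
    hF.comp measurable_translate_gapSet
  rw [lintegral_map hF hm, hν.lintegral_stationaryRenewalLaw (F := fun A => F (translate A t))
    (hF.comp hm), hν.lintegral_stationaryRenewalLaw hF]
  congr 1
  have hadd : MeasurePreserving (fun x : (ℤ → ℝ) × ℝ => (x.1, x.2 + t))
      ((gapLaw ν).prod volume) ((gapLaw ν).prod volume) :=
    (MeasurePreserving.id _).prod (measurePreserving_add_right volume t)
  have hind (t : ℝ) : Measurable ((gapInterval t).indicator (1 : (ℤ → ℝ) × ℝ → ℝ≥0∞)) :=
    measurable_one.indicator (measurableSet_gapInterval t)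
  calc _ = ∫⁻ x : (ℤ → ℝ) × ℝ, (gapInterval t).indicator 1 (x.1, x.2 + t) *
        F (translate (gapSet x.1) (x.2 + t)) ∂(gapLaw ν).prod volume := by
        refine lintegral_congr fun x => ?_
        rw [translate_translate, add_comm t]
        congr 1
        have : x ∈ gapInterval 0 ↔ (x.1, x.2 + t) ∈ gapInterval t := by
          simp only [gapInterval, Set.mem_ofPred_eq]
          constructor <;> rintro ⟨h1, h2⟩ <;> constructor <;> linarith
        by_cases hx : x ∈ gapInterval 0
        · rw [Set.indicator_of_mem hx, Set.indicator_of_mem (this.1 hx)]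
          rfl
        · rw [Set.indicator_of_notMem hx, Set.indicator_of_notMem fun h => hx (this.2 h)]
    _ = ∫⁻ x : (ℤ → ℝ) × ℝ, (gapInterval t).indicator 1 x *
        F (translate (gapSet x.1) x.2) ∂(gapLaw ν).prod volume :=
        hadd.lintegral_comp ((hind t).mul hG)
    _ = _ := lintegral_mul_eq_of_gapShift_invariant (hind t) (hind 0) hG
        (fun k x => by rw [translate_gapSet_gapShift]) (hν.ae_tsum_gapInterval t)
        (hν.ae_tsum_gapInterval 0)

theorem IsInterArrivalLaw.ae_locallyFinite (hν : IsInterArrivalLaw ν) :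
    ∀ᵐ A : Closeds ℝ ∂stationaryRenewalLaw ν, LocallyFinite (A : Set ℝ) := by
  have hm := measurableSet_locallyFinite.compl
  rw [ae_iff]
  change stationaryRenewalLaw ν {A : Closeds ℝ | LocallyFinite (A : Set ℝ)}ᶜ = 0
  rw [← lintegral_indicator_one hm,
    hν.lintegral_stationaryRenewalLaw (measurable_one.indicator hm)]
  refine mul_eq_zero_of_right _ ?_
  rw [lintegral_eq_zero_iff']
  · have h : ∀ᵐ x ∂(gapLaw ν).prod (volume : Measure ℝ), IsRegularGap x.1 :=
      Measure.quasiMeasurePreserving_fst.ae hν.ae_isRegularGap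
    filter_upwards [h] with x hx
    refine mul_eq_zero_of_right _ (Set.indicator_of_notMem (fun hn : ¬LocallyFinite _ => hn ?_) _)
    have : (gapSet x.1 : Set ℝ) = Set.range (gapSum x.1) := hx.locallyFinite.isClosed.closure_eq
    have h2 := hx.locallyFinite.preimage_add x.2
    rw [← this] at h2
    exact h2
  · exact ((measurable_one.indicator (measurableSet_gapInterval 0)).mul
      ((measurable_one.indicator hm).comp measurable_translate_gapSet)).aemeasurable

theorem IsInterArrivalLaw.isProbabilityMeasure_stationaryRenewalLaw (hν : IsInterArrivalLaw ν) :
    IsProbabilityMeasure (stationaryRenewalLaw ν) := by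
  have h0 : ∫⁻ x, ENNReal.ofReal x ∂ν ≠ 0 := by
    rw [← ofReal_integral_eq_lintegral_ofReal hν.integrable (hν.pos.mono fun x hx => hx.le)]
    simpa using hν.integral_pos
  have ht : ∫⁻ x, ENNReal.ofReal x ∂ν ≠ ∞ := by
    rw [← ofReal_integral_eq_lintegral_ofReal hν.integrable (hν.pos.mono fun x hx => hx.le)]
    exact ENNReal.ofReal_ne_top
  have h1 : IsProbabilityMeasure (lengthBiased ν) := ⟨by
    rw [lengthBiased, Measure.smul_apply, withDensity_apply _ .univ, Measure.restrict_univ,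
      smul_eq_mul, ENNReal.inv_mul_cancel h0 ht]⟩
  have h2 : IsProbabilityMeasure unif := ⟨by simp [unif]⟩
  exact Measure.isProbabilityMeasure_map measurable_closure_arrivals.aemeasurable

end Renewal

/-! ### The law of a Manhattan grid -/

section Grid

/-- A line in the grid that is not one of the parallel streets would have to be covered by the
orthogonal ones, whose coordinates would then fill the whole axis. -/
theorem hasLocallyFiniteLines_grid {H V : Closeds ℝ} (hH : LocallyFinite (H : Set ℝ))
    (hV : LocallyFinite (V : Set ℝ)) : HasLocallyFiniteLines (grid H V) := by
  have key {A B : Set ℝ} (hA : LocallyFinite A) {C : Set ℝ} (hB : LocallyFinite B)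
      (h : ∀ x ∈ C, ∀ t, t ∈ A ∨ x ∈ B) : LocallyFinite C := by
    intro a b
    refine (hB a b).subset (Set.inter_subset_inter_left _ fun x hx => ?_)
    by_contra hxB
    have : (Set.univ ∩ Set.Ioc (0 : ℝ) 1).Finite :=
      (hA 0 1).subset (Set.inter_subset_inter_left _ fun t _ => (h x hx t).resolve_right hxB)
    rw [Set.univ_inter] at this
    exact Set.Ioc_infinite one_pos this
  intro i
  fin_cases i
  · refine key hH hV fun x hx t => ?_
    have := hx !₂[x, t] rfl
    simpa [grid] using this
  · refine key hV hH fun x hx t => ?_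
    have := hx !₂[t, x] rfl
    exact Or.symm (by simpa [grid] using this)

variable {νh νv : Measure ℝ} [IsProbabilityMeasure νh] [IsProbabilityMeasure νv]

theorem isProbabilityMeasure_manhattanLaw (hνh : IsInterArrivalLaw νh)
    (hνv : IsInterArrivalLaw νv) : IsProbabilityMeasure (manhattanLaw νh νv) := by
  have := hνh.isProbabilityMeasure_stationaryRenewalLaw
  have := hνv.isProbabilityMeasure_stationaryRenewalLaw
  exact Measure.isProbabilityMeasure_map measurable_grid.aemeasurable

theorem isStationary_manhattanLaw (hνh : IsInterArrivalLaw νh) (hνv : IsInterArrivalLaw νv) :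
    IsStationary (manhattanLaw νh νv) := by
  have := hνh.isProbabilityMeasure_stationaryRenewalLaw
  have := hνv.isProbabilityMeasure_stationaryRenewalLaw
  intro y
  have h := (hνh.measurePreserving_translate (y 1)).prod (hνv.measurePreserving_translate (y 0))
  rw [manhattanLaw, Measure.map_map (measurable_shift_const y) measurable_grid]
  conv_rhs => rw [← h.map_eq, Measure.map_map measurable_grid h.measurable]
  rfl

theorem ae_hasLocallyFiniteLines_manhattanLaw (hνh : IsInterArrivalLaw νh)
    (hνv : IsInterArrivalLaw νv) : ∀ᵐ S ∂manhattanLaw νh νv, HasLocallyFiniteLines S := by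
  have := hνh.isProbabilityMeasure_stationaryRenewalLaw
  have := hνv.isProbabilityMeasure_stationaryRenewalLaw
  rw [manhattanLaw, ae_map_iff measurable_grid.aemeasurable measurableSet_hasLocallyFiniteLines]
  filter_upwards [Measure.quasiMeasurePreserving_fst.ae hνh.ae_locallyFinite,
    Measure.quasiMeasurePreserving_snd.ae hνv.ae_locallyFinite] with q h1 h2
  exact hasLocallyFiniteLines_grid h1 h2

end Grid

/-! ### Palm versions of nested random street systems -/

section InfinitePi

variable {α κ : Type*} {X : Type*} [MeasurableSpace X]
  (ρ : α ⊕ κ → Measure X) [∀ j, IsProbabilityMeasure (ρ j)]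

theorem map_inr_infinitePi :
    (Measure.infinitePi ρ).map (fun x i => x (Sum.inr i)) =
      Measure.infinitePi fun i => ρ (Sum.inr i) :=
  Measure.map_infinitePi_infinitePi_of_inj Sum.inr_injective

theorem map_inl_inr_infinitePi (a : α) :
    (Measure.infinitePi ρ).map (fun x => (x (Sum.inl a), fun i => x (Sum.inr i))) =
      (ρ (Sum.inl a)).prod (Measure.infinitePi fun i => ρ (Sum.inr i)) := by
  classical
  rw [← map_inr_infinitePi]
  exact map_eval_prod_infinitePi ρ (Sum.inl a) (g := fun x i => x (Sum.inr i))
    (by fun_prop) fun x r => by funext i; simp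

theorem map_inl_inl_inr_infinitePi {a b : α} (hab : a ≠ b) :
    (Measure.infinitePi ρ).map
        (fun x => (x (Sum.inl a), x (Sum.inl b), fun i => x (Sum.inr i))) =
      (ρ (Sum.inl a)).prod ((ρ (Sum.inl b)).prod (Measure.infinitePi fun i => ρ (Sum.inr i))) := by
  classical
  rw [← map_inl_inr_infinitePi]
  exact map_eval_prod_infinitePi ρ (Sum.inl a)
    (g := fun x => (x (Sum.inl b), fun i => x (Sum.inr i)))
    (by fun_prop) fun x r => by simp [hab.symm]

end InfinitePi

section Palm

variable {Ω Ω' : Type*} [MeasurableSpace Ω] [MeasurableSpace Ω'] {P : Measure Ω}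
  {P' : Measure Ω'} {S : Ω → StreetSystem} {S' : Ω' → StreetSystem} {f : StreetSystem → ℝ≥0∞}

theorem intensity_map (hS : AEMeasurable S P) : intensity (P.map S) id = intensity P S :=
  lintegral_map' (measurable_length_inter isCompact_unitSquare).aemeasurable hS

theorem lintegral_palmIntegral_map (hS : AEMeasurable S P) (h : intensity P S ≠ ∞)
    (hf : Measurable f) :
    ∫⁻ s, palmIntegral f s ∂P.map S = ∫⁻ ω, palmIntegral f (S ω) ∂P :=
  lintegral_map' (aemeasurable_palmIntegral hf
    (ae_length_lt_top (by rwa [intensity_map hS]))) hS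

theorem IsPalmVersion.map [IsProbabilityMeasure P'] (hS : AEMeasurable S P)
    (h : IsPalmVersion P S P' S') : IsPalmVersion (P.map S) id (P'.map S') id := by
  refine ⟨aemeasurable_id, fun f hf => ?_⟩
  simp only [id]
  rw [lintegral_map' hf.aemeasurable h.1, h.2 f hf, intensity_map hS]
  congr 1
  exact (lintegral_palmIntegral_map hS h.intensity_ne.2 hf).symm

/-- The property is translation invariant, so its failure contributes nothing to the Palm integral.
-/
theorem IsPalmVersion.ae_hasLocallyFiniteLines {μ μ' : Measure StreetSystem}
    (h : IsPalmVersion μ id μ' id) (hμ : ∀ᵐ S ∂μ, HasLocallyFiniteLines S) :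
    ∀ᵐ S ∂μ', HasLocallyFiniteLines S := by
  have hm := measurableSet_hasLocallyFiniteLines.compl
  have h2 := h.2 _ (measurable_one.indicator hm)
  simp only [id] at h2
  rw [lintegral_indicator_one hm] at h2
  rw [ae_iff]
  refine h2.trans (mul_eq_zero_of_right _ ?_)
  refine (lintegral_congr_ae ?_).trans lintegral_zero
  filter_upwards [hμ] with S hS
  refine (lintegral_congr fun y => ?_).trans lintegral_zero
  exact Set.indicator_of_notMem (not_not_intro (hS.shift y)) _

theorem lintegral_map_comp {α β : Type*} [MeasurableSpace α] [MeasurableSpace β] {X : Ω → α}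
    {g : α → β} {k : β → ℝ≥0∞} (hk : Measurable k) (hg : Measurable g) (hX : AEMeasurable X P) :
    ∫⁻ y, k y ∂P.map (fun ω => g (X ω)) = ∫⁻ x, k (g x) ∂P.map X := by
  rw [← lintegral_map hk hg, AEMeasurable.map_map_of_aemeasurable hg.aemeasurable hX]
  rfl

/-! ### The random choice between the two replacements -/

theorem unif_Iic {p : ℝ} (h1 : p ≤ 1) : unif (Set.Iic p) = ENNReal.ofReal p := by
  have : Set.Iic p ∩ Set.Icc 0 1 = Set.Icc 0 p := by
    ext x
    simp only [Set.mem_inter_iff, Set.mem_Iic, Set.mem_Icc]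
    exact ⟨fun h => ⟨h.2.1, h.1⟩, fun h => ⟨h.2, h.1, h.2.trans h1⟩⟩
  rw [unif, Measure.restrict_apply measurableSet_Iic, this, Real.volume_Icc, sub_zero]

theorem unif_Ioi {p : ℝ} (h0 : 0 ≤ p) : unif (Set.Ioi p) = ENNReal.ofReal (1 - p) := by
  have : Set.Ioi p ∩ Set.Icc 0 1 = Set.Ioc p 1 := by
    ext x
    simp only [Set.mem_inter_iff, Set.mem_Ioi, Set.mem_Icc, Set.mem_Ioc]
    exact ⟨fun h => ⟨h.1, h.2.2⟩, fun h => ⟨h.1, h0.trans h.1.le, h.2⟩⟩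
  rw [unif, Measure.restrict_apply measurableSet_Ioi, this, Real.volume_Ioc]

theorem lintegral_unif_ite {p : ℝ} (h0 : 0 ≤ p) (h1 : p ≤ 1) (a b : ℝ≥0∞) :
    ∫⁻ u, (if u ≤ p then a else b) ∂unif = ENNReal.ofReal p * a + ENNReal.ofReal (1 - p) * b := by
  have h : (fun u => if u ≤ p then a else b) =
      (Set.Iic p).indicator (fun _ => a) + (Set.Ioi p).indicator fun _ => b := by
    funext u
    by_cases hu : u ≤ p
    · simp [hu]
    · simp [hu, lt_of_not_ge hu]
  rw [h, Pi.add_def, lintegral_add_left (measurable_const.indicator measurableSet_Iic),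
    lintegral_indicator measurableSet_Iic, lintegral_indicator measurableSet_Ioi,
    setLIntegral_const, setLIntegral_const, unif_Iic h1, unif_Ioi h0, mul_comm a, mul_comm b]

/-- The Palm version of a stationary street system with independent copies of another stationary
street system nested into its blocks. -/
theorem isPalmVersion_nest [IsProbabilityMeasure P] {μ τ : Measure StreetSystem}
    (hμ : IsStationary μ) (hτ : IsStationary τ) (hlines : ∀ᵐ S ∂μ, HasLocallyFiniteLines S)
    {T : ℤ × ℤ → Ω → StreetSystem} {Sstar Tstar : Ω → StreetSystem} {U : Ω → ℝ}
    (hS : HasLaw S μ P) (hT : ∀ i, HasLaw (T i) τ P)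
    (hSstar : IsPalmVersion P S P Sstar) (hTstar : IsPalmVersion P (T 0) P Tstar)
    (hU : HasLaw U unif P)
    (hindep : iIndepFun (Sum.elim ![S, Sstar, Tstar] T : Fin 3 ⊕ (ℤ × ℤ) → Ω → StreetSystem) P)
    (hUindep : IndepFun U
      (fun ω (j : Fin 3 ⊕ (ℤ × ℤ)) => (Sum.elim ![S, Sstar, Tstar] T) j ω) P) :
    intensity P (fun ω => nest (S ω) fun i => T i ω) = intensity P S + intensity P (T 0) ∧
      IsPalmVersion P (fun ω => nest (S ω) fun i => T i ω) P fun ω =>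
        if U ω ≤ (intensity P S / intensity P fun ω => nest (S ω) fun i => T i ω).toReal then
          nest (Sstar ω) fun i => T i ω
        else
          nest (S ω) (Function.update (fun i => T i ω) 0 (Tstar ω)) := by
  obtain ⟨hγ0, hγt⟩ := hSstar.intensity_ne
  have hγ₁t := hTstar.intensity_ne.2
  have hμ' := hSstar.map hS.aemeasurable
  have hτ' := hTstar.map (hT 0).aemeasurable
  rw [hS.map_eq] at hμ'
  rw [(hT 0).map_eq] at hτ'
  have hγμ : intensity μ id = intensity P S := by rw [← hS.map_eq, intensity_map hS.aemeasurable]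
  have hγτ : intensity τ id = intensity P (T 0) := by
    rw [← (hT 0).map_eq, intensity_map (hT 0).aemeasurable]
  have : IsProbabilityMeasure μ := hS.map_eq ▸ Measure.isProbabilityMeasure_map hS.aemeasurable
  have : IsProbabilityMeasure τ :=
    (hT 0).map_eq ▸ Measure.isProbabilityMeasure_map (hT 0).aemeasurable
  have : IsProbabilityMeasure (P.map Sstar) := Measure.isProbabilityMeasure_map hSstar.1
  have : IsProbabilityMeasure (P.map Tstar) := Measure.isProbabilityMeasure_map hTstar.1
  let X : Fin 3 ⊕ (ℤ × ℤ) → Ω → StreetSystem := Sum.elim ![S, Sstar, Tstar] T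
  have hX : ∀ j, AEMeasurable (X j) P := by
    rintro (j | i)
    · fin_cases j
      · exact hS.aemeasurable
      · exact hSstar.1
      · exact hTstar.1
    · exact (hT i).aemeasurable
  have hρ (j) : IsProbabilityMeasure (P.map (X j)) := Measure.isProbabilityMeasure_map (hX j)
  have hXm : AEMeasurable (fun ω j => X j ω) P := aemeasurable_pi_iff.2 hX
  have hXlaw : P.map (fun ω j => X j ω) = Measure.infinitePi fun j => P.map (X j) :=
    hindep.map_fun_eq_infinitePi_map₀' hX
  have hside : (Measure.infinitePi fun i => P.map (X (Sum.inr i))) = sideLaw τ := by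
    congr 1
    funext i
    exact (hT i).map_eq
  -- `F 0` holds the data of the nested grid, `F 1` those with the Palm main grid, and `G` those
  -- with the Palm side grid. Slot `0` of the side streets stays in `G` and is overwritten later.
  let F (a : Fin 3) (x : Fin 3 ⊕ (ℤ × ℤ) → StreetSystem) := (x (Sum.inl a), fun i => x (Sum.inr i))
  let G (x : Fin 3 ⊕ (ℤ × ℤ) → StreetSystem) :=
    (x (Sum.inl 0), x (Sum.inl 2), fun i => x (Sum.inr i))
  have hF (a) : Measurable (F a) := by fun_prop
  have hG : Measurable G := by fun_prop
  have hFlaw (a) : P.map (fun ω => F a fun j => X j ω) =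
      (P.map (X (Sum.inl a))).prod (sideLaw τ) := by
    rw [← hside, ← map_inl_inr_infinitePi (fun j => P.map (X j)), ← hXlaw]
    exact (AEMeasurable.map_map_of_aemeasurable (hF a).aemeasurable hXm).symm
  have hGlaw : P.map (fun ω => G fun j => X j ω) =
      μ.prod ((P.map Tstar).prod (sideLaw τ)) := by
    have h := map_inl_inl_inr_infinitePi (fun j => P.map (X j)) (show (0 : Fin 3) ≠ 2 by decide)
    rw [hside, ← hXlaw] at h
    refine (AEMeasurable.map_map_of_aemeasurable hG.aemeasurable hXm).symm.trans (h.trans ?_)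
    change (P.map S).prod ((P.map Tstar).prod (sideLaw τ)) = _
    rw [hS.map_eq]
  have hFm (a) : AEMeasurable (fun ω => F a fun j => X j ω) P := (hF a).comp_aemeasurable hXm
  have hGm : AEMeasurable (fun ω => G fun j => X j ω) P := hG.comp_aemeasurable hXm
  have hSlines : ∀ᵐ ω ∂P, HasLocallyFiniteLines (S ω) := by
    rw [← hS.map_eq] at hlines
    exact ae_of_ae_map hS.aemeasurable hlines
  have hSstar_lines : ∀ᵐ ω ∂P, HasLocallyFiniteLines (Sstar ω) :=
    ae_of_ae_map hSstar.1 (hμ'.ae_hasLocallyFiniteLines hlines)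
  let Sbar : Ω → StreetSystem := fun ω => nest (S ω) fun i => T i ω
  have hSbar : Sbar =ᵐ[P] fun ω => nestM (F 0 fun j => X j ω) := by
    filter_upwards [hSlines] with ω hω
    exact (hω.nestM_eq _).symm
  have hfin := ae_length_nestM_lt_top (τ := τ) hlines (hγμ ▸ hγt) (hγτ ▸ hγ₁t)
  have hpalm {f : StreetSystem → ℝ≥0∞} (hf : Measurable f) :
      ∫⁻ ω, palmIntegral f (Sbar ω) ∂P =
        intensity P S * ∫⁻ q, f (nestM q) ∂(P.map Sstar).prod (sideLaw τ) +
        intensity P (T 0) * ∫⁻ q, f (nestM (q.1, Function.update q.2.2 0 q.2.1))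
          ∂μ.prod ((P.map Tstar).prod (sideLaw τ)) := by
    have hpm : AEMeasurable (fun q => palmIntegral f (nestM q)) (μ.prod (sideLaw τ)) := by
      refine (aemeasurable_palmIntegral hf ?_).comp_measurable measurable_nestM
      exact (ae_map_iff measurable_nestM.aemeasurable (measurableSet_lt
        (measurable_length_inter isCompact_unitSquare) measurable_const)).2 hfin
    have h0 : P.map (fun ω => F 0 fun j => X j ω) = μ.prod (sideLaw τ) := by
      rw [hFlaw, ← hS.map_eq]
      rfl
    rw [← hγμ, ← hγτ, ← IsPalmVersion.lintegral_palmIntegral_nest hμ hτ hlines hμ' hτ' hf]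
    rw [← h0] at hpm ⊢
    rw [lintegral_map' hpm (hFm 0)]
    refine lintegral_congr_ae ?_
    filter_upwards [hSbar] with ω hω
    rw [hω]
  -- The Palm formula for the constant test function `1`.
  have hγbar : intensity P Sbar = intensity P S + intensity P (T 0) := by
    have h := hpalm (f := fun _ => 1) measurable_const
    simp only [lintegral_const, measure_univ, mul_one] at h
    rw [← h]
    simp [intensity, palmIntegral]
  refine ⟨hγbar, ?_⟩
  change IsPalmVersion P Sbar P fun ω =>
    if U ω ≤ (intensity P S / intensity P Sbar).toReal then nest (Sstar ω) fun i => T i ω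
    else nest (S ω) (Function.update (fun i => T i ω) 0 (Tstar ω))
  have hbar0 : intensity P Sbar ≠ 0 := fun h => hγ0 (add_eq_zero.1 (hγbar.symm.trans h)).1
  have hbart : intensity P Sbar ≠ ∞ := by
    rw [hγbar]
    exact ENNReal.add_ne_top.2 ⟨hγt, hγ₁t⟩
  set p : ℝ := (intensity P S / intensity P Sbar).toReal with hp
  have hle : intensity P S / intensity P Sbar ≤ 1 :=
    ENNReal.div_le_of_le_mul (by rw [hγbar, one_mul]; exact le_self_add)
  have hpof : ENNReal.ofReal p = intensity P S / intensity P Sbar :=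
    ENNReal.ofReal_toReal (ne_top_of_le_ne_top ENNReal.one_ne_top hle)
  have hp0 : 0 ≤ p := ENNReal.toReal_nonneg
  have hp1 : p ≤ 1 := ENNReal.toReal_le_of_le_ofReal zero_le_one (by simpa using hle)
  have hpof' : ENNReal.ofReal (1 - p) = intensity P (T 0) / intensity P Sbar := by
    rw [ENNReal.ofReal_sub _ hp0, hpof, ENNReal.ofReal_one, ← ENNReal.div_self hbar0 hbart]
    refine ENNReal.sub_eq_of_eq_add_rev (ne_top_of_le_ne_top ENNReal.one_ne_top hle) ?_
    rw [← ENNReal.add_div, hγbar]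
  let H : ℝ × (Fin 3 ⊕ (ℤ × ℤ) → StreetSystem) → StreetSystem := fun q =>
    if q.1 ≤ p then nestM (F 1 q.2)
    else nestM ((G q.2).1, Function.update (G q.2).2.2 0 (G q.2).2.1)
  have hGupd : Measurable fun q : StreetSystem × StreetSystem × (ℤ × ℤ → StreetSystem) =>
      nestM (q.1, Function.update q.2.2 0 q.2.1) := by
    have h : Measurable fun q : StreetSystem × StreetSystem × (ℤ × ℤ → StreetSystem) =>
        Function.update q.2.2 (0 : ℤ × ℤ) q.2.1 :=
      measurable_update'.comp ((measurable_snd.comp measurable_snd).prodMk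
        (measurable_fst.comp measurable_snd))
    exact measurable_nestM.comp (measurable_fst.prodMk h)
  have hH : Measurable H := by
    refine Measurable.ite (measurableSet_le measurable_fst measurable_const) ?_ ?_
    · exact measurable_nestM.comp ((hF 1).comp measurable_snd)
    · exact hGupd.comp (hG.comp measurable_snd)
  have hUX : AEMeasurable (fun ω => (U ω, fun j => X j ω)) P := hU.aemeasurable.prodMk hXm
  have hUXlaw : P.map (fun ω => (U ω, fun j => X j ω)) = unif.prod (P.map fun ω j => X j ω) := by
    rw [← hU.map_eq]
    exact (indepFun_iff_map_prod_eq_prod_map_map hU.aemeasurable hXm).1 hUindep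
  have hae : (fun ω => if U ω ≤ p then nest (Sstar ω) fun i => T i ω
      else nest (S ω) (Function.update (fun i => T i ω) 0 (Tstar ω))) =ᵐ[P]
      fun ω => H (U ω, fun j => X j ω) := by
    filter_upwards [hSlines, hSstar_lines] with ω h1 h2
    simp only [H]
    congr 1
    · exact (h2.nestM_eq _).symm
    · exact (h1.nestM_eq _).symm
  refine ⟨(hH.comp_aemeasurable hUX).congr hae.symm, fun f hf => ?_⟩
  rw [lintegral_congr_ae (hae.mono fun ω hω => congrArg f hω)]
  have : SFinite (P.map fun ω j => X j ω) := inferInstance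
  rw [← lintegral_map' (f := fun q => f (H q)) (hf.comp hH).aemeasurable hUX, hUXlaw,
    lintegral_prod (fun q => f (H q)) (hf.comp hH).aemeasurable]
  have hA : ∫⁻ x, f (nestM (F 1 x)) ∂(P.map fun ω j => X j ω) =
      ∫⁻ q, f (nestM q) ∂(P.map Sstar).prod (sideLaw τ) := by
    have h1 : P.map (fun ω => F 1 fun j => X j ω) = (P.map Sstar).prod (sideLaw τ) := hFlaw 1
    rw [← h1]
    exact (lintegral_map_comp (hf.comp measurable_nestM) (hF 1) hXm).symm
  have hB : ∫⁻ x, f (nestM ((G x).1, Function.update (G x).2.2 0 (G x).2.1))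
        ∂(P.map fun ω j => X j ω) =
      ∫⁻ q, f (nestM (q.1, Function.update q.2.2 0 q.2.1))
        ∂μ.prod ((P.map Tstar).prod (sideLaw τ)) := by
    rw [← hGlaw]
    exact (lintegral_map_comp (hf.comp hGupd) hG hXm).symm
  have hinner (u : ℝ) : ∫⁻ x, f (H (u, x)) ∂(P.map fun ω j => X j ω) =
      if u ≤ p then ∫⁻ q, f (nestM q) ∂(P.map Sstar).prod (sideLaw τ)
      else ∫⁻ q, f (nestM (q.1, Function.update q.2.2 0 q.2.1))
        ∂μ.prod ((P.map Tstar).prod (sideLaw τ)) := by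
    by_cases hu : u ≤ p
    · simp only [H, hu, if_true]
      exact hA
    · simp only [H, hu, if_false]
      exact hB
  simp only [hinner]
  -- The two probabilities are the shares of the intensities in their sum, so the mixture is the
  -- Palm formula divided by the total intensity.
  rw [lintegral_unif_ite hp0 hp1, hpof, hpof']
  change _ = (intensity P Sbar)⁻¹ * ∫⁻ ω, palmIntegral f (Sbar ω) ∂P
  rw [hpalm hf, mul_add, div_eq_mul_inv, div_eq_mul_inv, ← mul_assoc, ← mul_assoc,
    mul_comm (intensity P Sbar)⁻¹, mul_comm (intensity P Sbar)⁻¹]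

end Palm

end Manhattan

end

open Manhattan in
theorem theorem2 {Ω : Type*} [MeasurableSpace Ω] (P : Measure Ω) [IsProbabilityMeasure P]
    -- inter-arrival distributions of the main streets and of the side streets
    (νh νv νh₁ νv₁ : Measure ℝ)
    [IsProbabilityMeasure νh] [IsProbabilityMeasure νv]
    [IsProbabilityMeasure νh₁] [IsProbabilityMeasure νv₁]
    (hνh : IsInterArrivalLaw νh) (hνv : IsInterArrivalLaw νv)
    (hνh₁ : IsInterArrivalLaw νh₁) (hνv₁ : IsInterArrivalLaw νv₁)
    -- the main grid, the side-street grids, the Palm versions of the main grid and of the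
    -- side-street grid of the block of the origin, and the uniform random variable
    (S : Ω → StreetSystem) (T : ℤ × ℤ → Ω → StreetSystem)
    (Sstar Tstar : Ω → StreetSystem) (U : Ω → ℝ)
    (hS : HasLaw S (manhattanLaw νh νv) P)
    (hT : ∀ i, HasLaw (T i) (manhattanLaw νh₁ νv₁) P)
    (hSstar : IsPalmVersion P S P Sstar)
    (hTstar : IsPalmVersion P (T (0, 0)) P Tstar)
    (hU : HasLaw U unif P)
    (hindep : iIndepFun (Sum.elim ![S, Sstar, Tstar] T : Fin 3 ⊕ (ℤ × ℤ) → Ω → StreetSystem) P)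
    (hUindep : IndepFun U
      (fun ω (j : Fin 3 ⊕ (ℤ × ℤ)) => (Sum.elim ![S, Sstar, Tstar] T) j ω) P) :
    let Sbar : Ω → StreetSystem := fun ω => nest (S ω) (fun i => T i ω)
    let γ := intensity P S
    let γ₁ := intensity P (T (0, 0))
    let γbar := intensity P Sbar
    γbar = γ + γ₁ ∧
      IsPalmVersion P Sbar P (fun ω =>
        if U ω ≤ (γ / γbar).toReal then
          nest (Sstar ω) (fun i => T i ω)
        else
          nest (S ω) (Function.update (fun i => T i ω) (0, 0) (Tstar ω))) := by
  have := isProbabilityMeasure_manhattanLaw hνh hνv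
  have := isProbabilityMeasure_manhattanLaw hνh₁ hνv₁
  exact isPalmVersion_nest (isStationary_manhattanLaw hνh hνv)
    (isStationary_manhattanLaw hνh₁ hνv₁) (ae_hasLocallyFiniteLines_manhattanLaw hνh hνv)
    hS hT hSstar hTstar hU hindep hUindep
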